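/- Let $R>0$, $p>1$, and let $a:[0,R]\to\mathbb{R}$ be continuous with $a(x)>0$ for all $x\in[0,R]$. Let $\mathcal{B}$ be one of the boundary operators $$\mathcal{D}u(0)=u(0),\qquad \mathcal{N}u(0)=-u'(0),\qquad \mathcal{R}_\beta u(0)=-u'(0)+\beta u(0)\quad(\beta\in\mathbb{R}).$$ For $\lambda\in\mathbb{R}$ consider the singular problem $$-u''=\lambda u-a(x)|u|^{p-1}u\ \text{ in }[0,R),\qquad \mathcal{B}u(0)=0,\qquad \lim_{x\uparrow R}u(x)=+\infty. \tag{1}$$ A positive solution of (1) is a function $u\in C^2([0,R);\mathbb{R})$ that satisfies (1) and $u(x)>0$ for all $x\in(0,R)$. Then: (a) For every $\lambda\in\mathbb{R}$, problem (1) has a minimal positive solution $L^{\min}_\lambda$ and a maximal positive solution $L^{\max}_\lambda$: both are positive solutions of (1), and every positive solution $L$ of (1) satisfies $L^{\min}_\lambda(x)\le L(x)\le L^{\max}_\lambda(x)$ for all $x\in[0,R)$. (b) If $\mathcal{B}\neq\mathcal{D}$, then $L^{\min}_\lambda\to+\infty$ as $\lambda\to+\infty$, uniformly on compact subsets of $[0,R)$.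 If $\mathcal{B}=\mathcal{D}$, then $L^{\min}_\lambda\to+\infty$ as $\lambda\to+\infty$, uniformly on compact subsets of $(0,R)$, while $L^{\min}_\lambda(0)=0$ for all $\lambda\in\mathbb{R}$. (c) $L^{\max}_\lambda\to0$ as $\lambda\to-\infty$, uniformly on compact subsets of $[0,R)$. (d) If, in addition, $a$ is non-increasing in $[0,R]$, $\lambda\ge0$, and $\mathcal{B}=\mathcal{D}$, $\mathcal{B}=\mathcal{N}$, or $\mathcal{B}=\mathcal{R}_\beta$ with $\beta<0$, then $L^{\min}_\lambda=L^{\max}_\lambda$ in $[0,R)$; thus (1) has a unique positive solution. -/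

import Mathlib

open Set Filter Topology

/-- The boundary operators at the left endpoint `0`: Dirichlet, Neumann, or Robin with an
arbitrary real coefficient `β`. -/
inductive BoundaryOp : Type where
  | dirichlet : BoundaryOp
  | neumann : BoundaryOp
  | robin (β : ℝ) : BoundaryOp

/-- The value `𝓑u(0)` in terms of the Cauchy data `u₀ = u(0)` and `u₁ = u'(0)`. The exterior normal
derivative at `0` is `-u'(0)`. -/
def BoundaryOp.apply : BoundaryOp → ℝ → ℝ → ℝ
  | .dirichlet, u₀, _ => u₀
  | .neumann, _, u₁ => -u₁
  | .robin β, u₀, u₁ => -u₁ + β * u₀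

/-- `u` is a positive solution, of class `C²` on `[0,R)`, of
`-u'' = l u - a(x) |u|^(p-1) u` in `[0,R)`, `𝓑u(0) = 0`, `u(R) = +∞`.
Derivatives are one-sided at `0`, and only the values of `u` on `[0,R)` matter.
Positivity is required in the open interval, since `u(0) = 0` in the Dirichlet case. -/
structure IsPositiveSolution (R p : ℝ) (a : ℝ → ℝ) (B : BoundaryOp) (l : ℝ) (u : ℝ → ℝ) :
    Prop where
  contDiffOn : ContDiffOn ℝ 2 u (Ico 0 R)
  pos : ∀ x ∈ Ioo 0 R, 0 < u x
  equation : ∀ x ∈ Ico 0 R,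
    -derivWithin (derivWithin u (Ico 0 R)) (Ico 0 R) x
      = l * u x - a x * (|u x| ^ (p - 1) * u x)
  boundary : B.apply (u 0) (derivWithin u (Ico 0 R) 0) = 0
  blowup : Tendsto u (𝓝[<] R) atTop

/-- `u` is a minimal positive solution. -/
def IsMinimalPositiveSolution (R p : ℝ) (a : ℝ → ℝ) (B : BoundaryOp) (l : ℝ) (u : ℝ → ℝ) : Prop :=
  IsPositiveSolution R p a B l u ∧
    ∀ v : ℝ → ℝ, IsPositiveSolution R p a B l v → ∀ x ∈ Ico 0 R, u x ≤ v x

/-- `u` is a maximal positive solution. -/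
def IsMaximalPositiveSolution (R p : ℝ) (a : ℝ → ℝ) (B : BoundaryOp) (l : ℝ) (u : ℝ → ℝ) : Prop :=
  IsPositiveSolution R p a B l u ∧
    ∀ v : ℝ → ℝ, IsPositiveSolution R p a B l v → ∀ x ∈ Ico 0 R, v x ≤ u x

/-- `L l → +∞` as `l → +∞`, uniformly on compact subsets of `s`. -/
def TendstoInftyOnCompacts (L : ℝ → ℝ → ℝ) (s : Set ℝ) : Prop :=
  ∀ K ⊆ s, IsCompact K → ∀ M : ℝ, ∀ᶠ l in atTop, ∀ x ∈ K, M < L l x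

/-!
All comparisons between (sub- and super-)solutions rest on the Wronskian `v' u - v u'`. Because
`u ↦ |u|^(p-1)` is nondecreasing for `u > 0`, the Wronskian of a subsolution `v` and a positive
supersolution `u` is nondecreasing wherever `v ≥ u`, and the boundary condition makes it nonnegative
at `0`. So once `v > u` at a point, the quotient `v / u` does not decrease any more, which is
impossible if `v ≤ u` at the right endpoint, or if `u` blows up there and `v` does not
(`comparison`). This orders solutions by their values at the right endpoint.

With a finite value `M` at the right endpoint, a positive solution is obtained by monotone iteration
between `0` and an exponential supersolution (`exists_finite_solution`); the iteration step, a linear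
boundary value problem, is solved explicitly. A supersolution of the form
`A exp(-γ x) (b - x)^(-2/(p-1))` bounds all solutions away from `b`, independently of `M`
(`exists_barrier`, `exists_upper_bound`). Hence the solutions with the values `1, 2, 3, …` at `R`
increase to a solution that blows up at `R`, and by comparison it is the minimal one
(`exists_minimal`). The minimal solutions on `[0, b n)`, `b n ↑ R`, decrease to the maximal solution
(`exists_maximal`). Limits of solutions are solutions by Taylor's formula with integral remainder and
dominated convergence (`exists_limit_of_tendsto`).

As `λ → +∞`, any fixed multiple of a suitable profile is a subsolution (`eventually_mul_le`). As
`λ → -∞`, the solutions are bounded on compact subsets uniformly in `λ ≤ 0`, and the linear term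
`-λ u` then forces exponential decay (`eventually_lt_atBot`). If `a` is nonincreasing, the translate
`x ↦ v (x - δ)` of a solution is a subsolution; if a solution `v` were larger than a solution `u`, a
small translate would still be larger at some point, but it stays finite at `R`, contradicting the
comparison principle (`le_of_antitoneOn`).
-/

/-! ### Wronskians and the comparison principle -/

/-- `u'` and `u''` are the first and second derivatives of `u` on `s`, in the sense of
`HasDerivWithinAt`; the derivatives at an endpoint of `s` are one-sided. -/
def HasTwoDerivsOn (s : Set ℝ) (u u' u'' : ℝ → ℝ) : Prop :=
  ∀ x ∈ s, HasDerivWithinAt u (u' x) s x ∧ HasDerivWithinAt u' (u'' x) s x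

namespace HasTwoDerivsOn

variable {s t : Set ℝ} {u u' u'' v v' v'' : ℝ → ℝ}

lemma mono (h : HasTwoDerivsOn s u u' u'') (hts : t ⊆ s) : HasTwoDerivsOn t u u' u'' :=
  fun x hx => ⟨(h x (hts hx)).1.mono hts, (h x (hts hx)).2.mono hts⟩

lemma continuousOn (h : HasTwoDerivsOn s u u' u'') : ContinuousOn u s :=
  fun x hx => (h x hx).1.continuousWithinAt

lemma of_forall (h : ∀ x ∈ s, HasDerivAt u (u' x) x) (h' : ∀ x ∈ s, HasDerivAt u' (u'' x) x) :
    HasTwoDerivsOn s u u' u'' :=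
  fun x hx => ⟨(h x hx).hasDerivWithinAt, (h' x hx).hasDerivWithinAt⟩

lemma sub (hu : HasTwoDerivsOn s u u' u'') (hv : HasTwoDerivsOn s v v' v'') :
    HasTwoDerivsOn s (fun x => u x - v x) (fun x => u' x - v' x) (fun x => u'' x - v'' x) :=
  fun x hx => ⟨(hu x hx).1.sub (hv x hx).1, (hu x hx).2.sub (hv x hx).2⟩

lemma hasDerivAt (h : HasTwoDerivsOn s u u' u'') {x : ℝ} (hx : s ∈ 𝓝 x) :
    HasDerivAt u (u' x) x :=
  (h x (mem_of_mem_nhds hx)).1.hasDerivAt hx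

lemma hasDerivAt' (h : HasTwoDerivsOn s u u' u'') {x : ℝ} (hx : s ∈ 𝓝 x) :
    HasDerivAt u' (u'' x) x :=
  (h x (mem_of_mem_nhds hx)).2.hasDerivAt hx

/-- The derivative of the Wronskian `v' u - v u'` is `v'' u - v u''`. -/
lemma wronskian (hv : HasTwoDerivsOn s v v' v'') (hu : HasTwoDerivsOn s u u' u'') {x : ℝ}
    (hx : x ∈ s) :
    HasDerivWithinAt (fun y => v' y * u y - v y * u' y) (v'' x * u x - v x * u'' x) s x := by
  have := ((hv x hx).2.mul (hu x hx).1).sub ((hv x hx).1.mul (hu x hx).2)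
  refine this.congr_deriv ?_
  ring

/-- If the Wronskian `v' u - v u'` is nonnegative at `c` and nondecreasing, then it stays
nonnegative. -/
lemma wronskian_nonneg {c e : ℝ} (hv : HasTwoDerivsOn (Icc c e) v v' v'')
    (hu : HasTwoDerivsOn (Icc c e) u u' u'')
    (hW : ∀ x ∈ Ioo c e, 0 ≤ v'' x * u x - v x * u'' x)
    (hc : 0 ≤ v' c * u c - v c * u' c) {x : ℝ} (hx : x ∈ Icc c e) :
    0 ≤ v' x * u x - v x * u' x := by
  have hmono : MonotoneOn (fun y => v' y * u y - v y * u' y) (Icc c e) := by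
    refine monotoneOn_of_hasDerivWithinAt_nonneg (convex_Icc c e)
      (fun y hy => (hv.wronskian hu hy).continuousWithinAt)
      (f' := fun y => v'' y * u y - v y * u'' y) ?_ ?_
    · intro y hy
      exact (hv.wronskian hu (interior_subset hy)).mono interior_subset
    · intro y hy
      rw [interior_Icc] at hy
      exact hW y hy
  exact hc.trans (hmono (left_mem_Icc.2 (hx.1.trans hx.2)) hx hx.1)

/-- If the Wronskian `v' u - v u'` is nonnegative at `c` and nondecreasing, then `v / u` is
nondecreasing wherever `u` is positive. -/
lemma div_le_div_of_wronskian {c x₀ e : ℝ} (hv : HasTwoDerivsOn (Icc c e) v v' v'')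
    (hu : HasTwoDerivsOn (Icc c e) u u' u'')
    (hW : ∀ x ∈ Ioo c e, 0 ≤ v'' x * u x - v x * u'' x)
    (hc : 0 ≤ v' c * u c - v c * u' c) (hcx : c ≤ x₀) (hxe : x₀ ≤ e)
    (hpos : ∀ x ∈ Icc x₀ e, 0 < u x) : v x₀ / u x₀ ≤ v e / u e := by
  have hsub : Icc x₀ e ⊆ Icc c e := Icc_subset_Icc_left hcx
  have hd : ∀ y ∈ Icc x₀ e, HasDerivWithinAt (fun y => v y / u y)
      ((v' y * u y - v y * u' y) / u y ^ 2) (Icc x₀ e) y := fun y hy =>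
    ((hv.mono hsub) y hy).1.div ((hu.mono hsub) y hy).1 (hpos y hy).ne'
  have hmono : MonotoneOn (fun y => v y / u y) (Icc x₀ e) := by
    refine monotoneOn_of_hasDerivWithinAt_nonneg (convex_Icc x₀ e)
      (fun y hy => (hd y hy).continuousWithinAt)
      (f' := fun y => (v' y * u y - v y * u' y) / u y ^ 2) ?_ ?_
    · intro y hy
      exact (hd y (interior_subset hy)).mono interior_subset
    · intro y hy
      have hy' := hsub (interior_subset hy)
      exact div_nonneg (wronskian_nonneg hv hu hW hc hy') (sq_nonneg _)
  exact hmono (left_mem_Icc.2 hxe) (right_mem_Icc.2 hxe) hxe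

end HasTwoDerivsOn

/-- A function with positive derivative at `x` is larger than its value at `x` immediately to the
right of `x`. -/
lemma HasDerivAt.eventually_gt_right {f : ℝ → ℝ} {f' x : ℝ} (h : HasDerivAt f f' x) (hf' : 0 < f') :
    ∀ᶠ y in 𝓝[>] x, f x < f y := by
  have h1 := (hasDerivAt_iff_tendsto_slope.1 h).mono_left
    (nhdsWithin_mono x (fun y (hy : y ∈ Ioi x) => (ne_of_gt hy : y ≠ x)))
  filter_upwards [h1.eventually (eventually_gt_nhds hf'), self_mem_nhdsWithin] with y hy hxy
  rw [slope_def_field] at hy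
  have hxy' : 0 < y - x := sub_pos.2 hxy
  have := (div_pos_iff_of_pos_right hxy').1 hy
  linarith

/-- The comparison principle. Suppose that the Wronskian of `v` and `u` is nonnegative at the left
endpoint `c` and nondecreasing wherever `v > u`. If `v > u` held at some point, the quotient `v / u`
would be nondecreasing from there on; so `v ≤ u` as soon as no bound `v ≥ r u` with `r > 1`
persists up to the right endpoint `d`. -/
theorem comparison {c d : ℝ} {v v' v'' u u' u'' : ℝ → ℝ}
    (hv : HasTwoDerivsOn (Ico c d) v v' v'') (hu : HasTwoDerivsOn (Ico c d) u u' u'')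
    (hpos : ∀ x ∈ Ioo c d, 0 < u x)
    (hW : ∀ x ∈ Ioo c d, u x < v x → 0 ≤ v'' x * u x - v x * u'' x)
    (hc : 0 ≤ v' c * u c - v c * u' c)
    (hd : ∀ x₀ ∈ Ioo c d, ∀ r > 1, ∃ x ∈ Ioo x₀ d, v x < r * u x) :
    ∀ x ∈ Ico c d, v x ≤ u x := by
  have hcv := hv.continuousOn
  have hcu := hu.continuousOn
  have key : ∀ x₀ ∈ Ioo c d, v x₀ ≤ u x₀ := by
    intro x₀ hx₀
    by_contra! hlt
    -- the left end `c'` of the maximal interval to the left of `x₀` on which `u < v`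
    obtain ⟨c', hcc', hc'x, hc'Z, hc'⟩ : ∃ c', c ≤ c' ∧ c' < x₀ ∧
        0 ≤ v' c' * u c' - v c' * u' c' ∧ ∀ x ∈ Ioc c' x₀, u x < v x := by
      have hsub : Icc c x₀ ⊆ Ico c d := fun x hx => ⟨hx.1, hx.2.trans_lt hx₀.2⟩
      have hcomp : IsCompact (Icc c x₀ ∩ {x | v x ≤ u x}) := by
        refine isCompact_Icc.of_isClosed_subset ?_ inter_subset_left
        exact isClosed_Icc.isClosed_le (hcv.mono hsub) (hcu.mono hsub)
      rcases (Icc c x₀ ∩ {x | v x ≤ u x}).eq_empty_or_nonempty with hemp | hne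
      · refine ⟨c, le_rfl, hx₀.1, hc, fun x hx => ?_⟩
        by_contra! hle
        exact (eq_empty_iff_forall_notMem.1 hemp x) ⟨⟨hx.1.le, hx.2⟩, hle⟩
      · obtain ⟨c', ⟨hc'm, hc'le⟩, hmax⟩ := hcomp.exists_isGreatest hne
        have hc'le : v c' ≤ u c' := hc'le
        have hlt' : c' < x₀ := lt_of_le_of_ne hc'm.2 (by rintro rfl; exact absurd hc'le hlt.not_ge)
        have hgt : ∀ x ∈ Ioc c' x₀, u x < v x := by
          intro x hx
          by_contra! hle
          exact absurd (hmax ⟨⟨hc'm.1.trans hx.1.le, hx.2⟩, hle⟩) hx.1.not_ge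
        refine ⟨c', hc'm.1, hlt', ?_, hgt⟩
        rcases hc'm.1.eq_or_lt with rfl | hlt''
        · exact hc
        · have hmem : c' ∈ Ioo c d := ⟨hlt'', hlt'.trans hx₀.2⟩
          have hn : Ico c d ∈ 𝓝 c' := Ico_mem_nhds hmem.1 hmem.2
          have hev : ∀ᶠ x in 𝓝[>] c', u x < v x := by
            filter_upwards [Ioc_mem_nhdsGT hlt'] with x hx using hgt x hx
          have hle2 : u c' ≤ v c' := by
            refine le_of_tendsto_of_tendsto ((hu.hasDerivAt hn).continuousAt.tendsto.mono_left
              nhdsWithin_le_nhds) ((hv.hasDerivAt hn).continuousAt.tendsto.mono_left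
              nhdsWithin_le_nhds) (hev.mono fun x hx => hx.le)
          have heq : v c' = u c' := le_antisymm hc'le hle2
          have hder : u' c' ≤ v' c' := by
            by_contra! hneg
            have h1 := ((hu.hasDerivAt hn).sub (hv.hasDerivAt hn)).eventually_gt_right
              (sub_pos.2 hneg)
            obtain ⟨x, hx1, hx2⟩ := (h1.and hev).exists
            simp only [Pi.sub_apply] at hx1
            linarith
          rw [heq]
          have := hpos c' hmem
          nlinarith
    have hratio : ∀ e ∈ Ico x₀ d, (∀ x ∈ Ioo c' e, u x < v x) → v x₀ / u x₀ ≤ v e / u e := by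
      intro e he hlt2
      have hsub : Icc c' e ⊆ Ico c d := fun x hx => ⟨hcc'.trans hx.1, hx.2.trans_lt he.2⟩
      refine (hv.mono hsub).div_le_div_of_wronskian (hu.mono hsub) (fun x hx => ?_) hc'Z hc'x.le
        he.1 (fun x hx => hpos x ⟨hx₀.1.trans_le hx.1, hx.2.trans_lt he.2⟩)
      exact hW x ⟨hcc'.trans_lt hx.1, hx.2.trans he.2⟩ (hlt2 x hx)
    have hr : 1 < v x₀ / u x₀ := (one_lt_div (hpos x₀ hx₀)).2 hlt
    have hall : ∀ x ∈ Ico x₀ d, u x < v x := by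
      intro x hx
      by_contra! hle
      have hsub : Icc x₀ x ⊆ Ico c d := fun y hy => ⟨hx₀.1.le.trans hy.1, hy.2.trans_lt hx.2⟩
      have hcomp : IsCompact (Icc x₀ x ∩ {x | v x ≤ u x}) := by
        refine isCompact_Icc.of_isClosed_subset ?_ inter_subset_left
        exact isClosed_Icc.isClosed_le (hcv.mono hsub) (hcu.mono hsub)
      obtain ⟨e, ⟨hem, hele⟩, hmin⟩ := hcomp.exists_isLeast ⟨x, ⟨hx.1, le_rfl⟩, hle⟩
      have hele : v e ≤ u e := hele
      have hed : e < d := hem.2.trans_lt hx.2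
      have h1 := hratio e ⟨hem.1, hed⟩ (fun y hy => by
        rcases le_or_gt y x₀ with h | h
        · exact hc' y ⟨hy.1, h⟩
        · by_contra! hle'
          exact absurd (hmin ⟨⟨h.le, hy.2.le.trans hem.2⟩, hle'⟩) hy.2.not_ge)
      have hue := hpos e ⟨hx₀.1.trans_le hem.1, hed⟩
      have := (div_le_one hue).2 hele
      linarith
    obtain ⟨x, hx, hxlt⟩ := hd x₀ hx₀ _ hr
    have h1 := hratio x ⟨hx.1.le, hx.2⟩ (fun y hy => by
      rcases le_or_gt y x₀ with h | h
      · exact hc' y ⟨hy.1, h⟩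
      · exact hall y ⟨h.le, hy.2.trans hx.2⟩)
    rw [le_div_iff₀ (hpos x ⟨hx₀.1.trans hx.1, hx.2⟩)] at h1
    linarith
  intro x hx
  rcases hx.1.eq_or_lt with rfl | h
  · have hcd := hx.2
    have hn : Ioo c d ∈ 𝓝[>] c := Ioo_mem_nhdsGT hcd
    have hle : 𝓝[>] c ≤ 𝓝[Ico c d] c :=
      (nhdsWithin_le_iff.2 (mem_of_superset hn Ioo_subset_Ico_self))
    exact le_of_tendsto_of_tendsto ((hcv c hx).mono_left hle) ((hcu c hx).mono_left hle)
      (by filter_upwards [hn] with y hy using key y hy)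
  · exact key x ⟨h, hx.2⟩

/-- The comparison principle when `v ≤ u` holds at the right endpoint. -/
theorem comparison_Icc {c d : ℝ} {v v' v'' u u' u'' : ℝ → ℝ}
    (hv : HasTwoDerivsOn (Icc c d) v v' v'') (hu : HasTwoDerivsOn (Icc c d) u u' u'')
    (hpos : ∀ x ∈ Ioc c d, 0 < u x)
    (hW : ∀ x ∈ Ioo c d, u x < v x → 0 ≤ v'' x * u x - v x * u'' x)
    (hc : 0 ≤ v' c * u c - v c * u' c) (hd : v d ≤ u d) :
    ∀ x ∈ Icc c d, v x ≤ u x := by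
  intro x hx
  rcases hx.2.eq_or_lt with rfl | h
  · exact hd
  refine comparison (hv.mono Ico_subset_Icc_self) (hu.mono Ico_subset_Icc_self)
    (fun y hy => hpos y ⟨hy.1, hy.2.le⟩) hW hc ?_ x ⟨hx.1, h⟩
  intro x₀ hx₀ r hr
  have hcd : c < d := hx.1.trans_lt h
  have hmem : d ∈ Icc c d := ⟨hcd.le, le_rfl⟩
  have hle : 𝓝[<] d ≤ 𝓝[Icc c d] d :=
    nhdsWithin_le_iff.2 (mem_of_superset (Ioo_mem_nhdsLT hcd) Ioo_subset_Icc_self)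
  have hud := hpos d ⟨hcd, le_rfl⟩
  have ht := ((hv.continuousOn d hmem).mono_left hle).sub
    (((hu.continuousOn d hmem).mono_left hle).const_mul r)
  have hneg : v d - r * u d < 0 := by nlinarith
  obtain ⟨y, hy1, hy2⟩ := ((ht.eventually (eventually_lt_nhds hneg)).and
    (Ioo_mem_nhdsLT hx₀.2)).exists
  exact ⟨y, hy2, by linarith⟩

/-- The comparison principle when `u` blows up at the right endpoint but `v` does not. -/
theorem comparison_of_tendsto {c d : ℝ} {v v' v'' u u' u'' : ℝ → ℝ}
    (hv : HasTwoDerivsOn (Icc c d) v v' v'') (hu : HasTwoDerivsOn (Ico c d) u u' u'')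
    (hpos : ∀ x ∈ Ioo c d, 0 < u x)
    (hW : ∀ x ∈ Ioo c d, u x < v x → 0 ≤ v'' x * u x - v x * u'' x)
    (hc : 0 ≤ v' c * u c - v c * u' c) (hd : Tendsto u (𝓝[<] d) atTop) :
    ∀ x ∈ Ico c d, v x ≤ u x := by
  refine comparison (hv.mono Ico_subset_Icc_self) hu hpos hW hc ?_
  intro x₀ hx₀ r hr
  have hcd : c < d := hx₀.1.trans hx₀.2
  have hmem : d ∈ Icc c d := ⟨hcd.le, le_rfl⟩
  have hle : 𝓝[<] d ≤ 𝓝[Icc c d] d :=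
    nhdsWithin_le_iff.2 (mem_of_superset (Ioo_mem_nhdsLT hcd) Ioo_subset_Icc_self)
  have ht := (hv.continuousOn d hmem).mono_left hle
  obtain ⟨y, ⟨hy1, hy2, hy3⟩, hy4⟩ := (((ht.eventually (eventually_lt_nhds (lt_add_one (v d)))).and
    ((hd.eventually_ge_atTop (v d + 1)).and (hd.eventually_ge_atTop 0))).and
    (Ioo_mem_nhdsLT hx₀.2)).exists
  refine ⟨y, hy4, ?_⟩
  nlinarith

/-! ### Boundary conditions and solutions -/

/-- The coefficient `β` of the condition `u'(0) = β u(0)` that a Neumann or Robin operator imposes;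
the value `0` in the Dirichlet case is a dummy. -/
def BoundaryOp.slope : BoundaryOp → ℝ
  | .dirichlet => 0
  | .neumann => 0
  | .robin β => β

lemma BoundaryOp.apply_eq_zero_iff {B : BoundaryOp} (hB : B ≠ .dirichlet) {u₀ u₁ : ℝ} :
    B.apply u₀ u₁ = 0 ↔ u₁ = B.slope * u₀ := by
  cases B with
  | dirichlet => exact absurd rfl hB
  | neumann => simp [BoundaryOp.apply, BoundaryOp.slope]
  | robin β =>
    simp only [BoundaryOp.apply, BoundaryOp.slope]
    constructor <;> intro h <;> linarith

/-- Two functions that satisfy the same boundary condition have vanishing Wronskian at `0`. -/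
lemma BoundaryOp.wronskian_eq_zero (B : BoundaryOp) {u₀ u₁ v₀ v₁ : ℝ} (hu : B.apply u₀ u₁ = 0)
    (hv : B.apply v₀ v₁ = 0) : v₁ * u₀ - v₀ * u₁ = 0 := by
  by_cases hB : B = .dirichlet
  · subst hB
    simp only [BoundaryOp.apply] at hu hv
    simp [hu, hv]
  · rw [BoundaryOp.apply_eq_zero_iff hB] at hu hv
    rw [hu, hv]
    ring

/-- The sign of the Wronskian at `0` of a function with `𝓑v(0) = 0` and a function `u` whose
Cauchy data make it a supersolution of the boundary condition. -/
lemma BoundaryOp.wronskian_nonneg (B : BoundaryOp) {u₀ u₁ v₀ v₁ : ℝ} (hv : B.apply v₀ v₁ = 0)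
    (hv₀ : 0 ≤ v₀) (hv₁ : v₀ = 0 → 0 ≤ v₁) (hu₀ : 0 ≤ u₀) (hu : u₁ ≤ B.slope * u₀) :
    0 ≤ v₁ * u₀ - v₀ * u₁ := by
  by_cases hB : B = .dirichlet
  · subst hB
    simp only [BoundaryOp.apply] at hv
    simpa [hv] using mul_nonneg (hv₁ hv) hu₀
  · rw [BoundaryOp.apply_eq_zero_iff hB] at hv
    rw [hv]
    nlinarith [mul_le_mul_of_nonneg_left hu hv₀]

lemma BoundaryOp.tendsto_apply (B : BoundaryOp) {ι : Type*} {f : Filter ι} {v w : ι → ℝ}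
    {v₀ w₀ : ℝ} (hv : Tendsto v f (𝓝 v₀)) (hw : Tendsto w f (𝓝 w₀)) :
    Tendsto (fun i => B.apply (v i) (w i)) f (𝓝 (B.apply v₀ w₀)) := by
  cases B with
  | dirichlet => exact hv
  | neumann => exact hw.neg
  | robin β => exact hw.neg.add (hv.const_mul β)

/-- On the set `s`, `u` is a solution of the differential equation with derivative `u'`; it
satisfies the boundary condition at `0` and is positive in `s ∩ (0,∞)`. Nothing is required at the
right end of `s`. -/
structure IsSolOn (s : Set ℝ) (p : ℝ) (a : ℝ → ℝ) (B : BoundaryOp) (l : ℝ) (u u' : ℝ → ℝ) :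
    Prop where
  derivs : HasTwoDerivsOn s u u' (fun x => a x * (|u x| ^ (p - 1) * u x) - l * u x)
  pos : ∀ x ∈ s, 0 < x → 0 < u x
  boundary : B.apply (u 0) (u' 0) = 0

namespace IsSolOn

variable {s t : Set ℝ} {p l R b : ℝ} {a u u' : ℝ → ℝ} {B : BoundaryOp}

lemma mono (h : IsSolOn s p a B l u u') (hts : t ⊆ s) : IsSolOn t p a B l u u' :=
  ⟨h.derivs.mono hts, fun x hx => h.pos x (hts hx), h.boundary⟩

lemma nonneg_zero (h : IsSolOn (Icc 0 b) p a B l u u') (hb : 0 < b) : 0 ≤ u 0 := by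
  have hle : 𝓝[>] (0 : ℝ) ≤ 𝓝[Icc 0 b] 0 :=
    nhdsWithin_le_iff.2 (mem_of_superset (Ioo_mem_nhdsGT hb) Ioo_subset_Icc_self)
  refine ge_of_tendsto ((h.derivs.continuousOn 0 ⟨le_rfl, hb.le⟩).mono_left hle) ?_
  filter_upwards [Ioo_mem_nhdsGT hb] with x hx
  exact (h.pos x ⟨hx.1.le, hx.2.le⟩ hx.1).le

lemma nonneg (h : IsSolOn (Icc 0 b) p a B l u u') (hb : 0 < b) {x : ℝ} (hx : x ∈ Icc 0 b) :
    0 ≤ u x := by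
  rcases hx.1.eq_or_lt with rfl | h0
  · exact h.nonneg_zero hb
  · exact (h.pos x hx h0).le

lemma deriv_nonneg_of_eq_zero (h : IsSolOn (Icc 0 b) p a B l u u') (hb : 0 < b) (h0 : u 0 = 0) :
    0 ≤ u' 0 := by
  have hd := (h.derivs 0 ⟨le_rfl, hb.le⟩).1
  rw [hasDerivWithinAt_iff_tendsto_slope] at hd
  have hle : 𝓝[>] (0 : ℝ) ≤ 𝓝[Icc 0 b \ {0}] 0 := by
    refine nhdsWithin_le_iff.2 (mem_of_superset (Ioo_mem_nhdsGT hb) fun x hx => ?_)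
    exact ⟨⟨hx.1.le, hx.2.le⟩, hx.1.ne'⟩
  refine ge_of_tendsto (hd.mono_left hle) ?_
  filter_upwards [Ioo_mem_nhdsGT hb] with x hx
  rw [slope_def_field, h0, sub_zero, sub_zero]
  exact div_nonneg (h.pos x ⟨hx.1.le, hx.2.le⟩ hx.1).le hx.1.le

lemma wronskian_nonneg (h : IsSolOn (Icc 0 b) p a B l u u') (hb : 0 < b) {w₀ w₁ : ℝ}
    (hw₀ : 0 ≤ w₀) (hw₁ : w₁ ≤ B.slope * w₀) : 0 ≤ u' 0 * w₀ - u 0 * w₁ :=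
  B.wronskian_nonneg h.boundary (h.nonneg_zero hb) (h.deriv_nonneg_of_eq_zero hb) hw₀ hw₁

end IsSolOn

/-- `u ↦ |u|^(p-1)` is nondecreasing for `u > 0`; hence the Wronskian of a subsolution `v` and a
supersolution `u` is nondecreasing wherever `v ≥ u`. -/
lemma wronskian_deriv_nonneg {p a l u v u₂ v₂ : ℝ} (hp : 1 < p) (ha : 0 ≤ a) (hu : 0 < u)
    (huv : u ≤ v) (hv₂ : a * (|v| ^ (p - 1) * v) - l * v ≤ v₂)
    (hu₂ : u₂ ≤ a * (|u| ^ (p - 1) * u) - l * u) : 0 ≤ v₂ * u - v * u₂ := by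
  have hv : 0 < v := hu.trans_le huv
  have hpow : |u| ^ (p - 1) ≤ |v| ^ (p - 1) := by
    rw [abs_of_pos hu, abs_of_pos hv]
    exact Real.rpow_le_rpow hu.le huv (by linarith)
  have h1 := mul_le_mul_of_nonneg_right hv₂ hu.le
  have h2 := mul_le_mul_of_nonneg_left hu₂ hv.le
  have h3 : 0 ≤ (a * v * u) * (|v| ^ (p - 1) - |u| ^ (p - 1)) :=
    mul_nonneg (by positivity) (sub_nonneg.2 hpow)
  nlinarith

lemma continuous_abs_rpow_mul {p : ℝ} (hp : 1 < p) : Continuous fun u : ℝ => |u| ^ (p - 1) * u :=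
  (continuous_abs.rpow_const fun _ => Or.inr (by linarith)).mul continuous_id

lemma continuousOn_rhs {p l : ℝ} {s : Set ℝ} {a u : ℝ → ℝ} (hp : 1 < p) (ha : ContinuousOn a s)
    (hu : ContinuousOn u s) :
    ContinuousOn (fun x => a x * (|u x| ^ (p - 1) * u x) - l * u x) s :=
  (ha.mul ((continuous_abs_rpow_mul hp).comp_continuousOn hu)).sub (hu.const_smul l)

/-- A positive solution of the singular problem is a solution on `[0,R)` that blows up at `R`. -/
lemma IsPositiveSolution.isSolOn {R p l : ℝ} {a u : ℝ → ℝ} {B : BoundaryOp}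
    (h : IsPositiveSolution R p a B l u) :
    IsSolOn (Ico 0 R) p a B l u (derivWithin u (Ico 0 R)) := by
  have hud : UniqueDiffOn ℝ (Ico 0 R) := uniqueDiffOn_Ico 0 R
  have h1 : ContDiffOn ℝ 1 (derivWithin u (Ico 0 R)) (Ico 0 R) :=
    h.contDiffOn.derivWithin hud (by norm_num)
  refine ⟨fun x hx => ⟨?_, ?_⟩, fun x hx h0 => h.pos x ⟨h0, hx.2⟩, h.boundary⟩
  · exact ((h.contDiffOn.differentiableOn (by norm_num)) x hx).hasDerivWithinAt
  · refine ((h1.differentiableOn (by norm_num)) x hx).hasDerivWithinAt.congr_deriv ?_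
    linarith [h.equation x hx]

lemma IsSolOn.isPositiveSolution {R p l : ℝ} {a u u' : ℝ → ℝ} {B : BoundaryOp} (hR : 0 < R)
    (hp : 1 < p) (ha : ContinuousOn a (Icc 0 R)) (h : IsSolOn (Ico 0 R) p a B l u u')
    (hblow : Tendsto u (𝓝[<] R) atTop) : IsPositiveSolution R p a B l u := by
  have hud : UniqueDiffOn ℝ (Ico 0 R) := uniqueDiffOn_Ico 0 R
  have h1 : EqOn (derivWithin u (Ico 0 R)) u' (Ico 0 R) := fun x hx =>
    (h.derivs x hx).1.derivWithin (hud x hx)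
  have h2 : ∀ x ∈ Ico 0 R, derivWithin (derivWithin u (Ico 0 R)) (Ico 0 R) x =
      a x * (|u x| ^ (p - 1) * u x) - l * u x := fun x hx => by
    rw [derivWithin_congr h1 (h1 hx)]
    exact (h.derivs x hx).2.derivWithin (hud x hx)
  refine ⟨?_, fun x hx => h.pos x ⟨hx.1.le, hx.2⟩ hx.1, fun x hx => ?_, ?_, hblow⟩
  · have hd' : ContDiffOn ℝ 1 (derivWithin u (Ico 0 R)) (Ico 0 R) := by
      rw [show (1 : WithTop ℕ∞) = 0 + 1 by norm_num, contDiffOn_succ_iff_derivWithin hud]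
      refine ⟨fun x hx => ?_, by simp, ?_⟩
      · exact ((h.derivs x hx).2.congr h1 (h1 hx)).differentiableWithinAt
      · rw [contDiffOn_zero]
        exact (continuousOn_rhs hp (ha.mono Ico_subset_Icc_self) h.derivs.continuousOn).congr h2
    rw [show (2 : WithTop ℕ∞) = 1 + 1 by norm_num, contDiffOn_succ_iff_derivWithin hud]
    exact ⟨fun x hx => (h.derivs x hx).1.differentiableWithinAt, by simp, hd'⟩
  · rw [h2 x hx]
    ring
  · rw [h1 ⟨le_rfl, hR⟩]
    exact h.boundary

/-! ### Linear boundary value problems and limits -/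

lemma continuous_IccExtend_of_continuousOn {b : ℝ} (hb : 0 ≤ b) {h : ℝ → ℝ}
    (hh : ContinuousOn h (Icc 0 b)) :
    ∃ H : ℝ → ℝ, Continuous H ∧ EqOn H h (Icc 0 b) :=
  ⟨IccExtend hb (fun x : Icc 0 b => h x), (continuousOn_iff_continuous_domRestrict.1 hh).Icc_extend',
    fun _ hx => IccExtend_of_mem hb _ hx⟩

lemma Continuous.hasDerivAt_primitive {h : ℝ → ℝ} (hh : Continuous h) (x : ℝ) :
    HasDerivAt (fun y => ∫ t in (0 : ℝ)..y, h t) (h x) x :=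
  (hh.integral_hasStrictDerivAt 0 x).hasDerivAt

/-- The solution of `ψ'' = κ² ψ` determined up to a factor by the boundary condition at `0`; it is
positive on `(0,∞)` when `κ` is large. -/
lemma BoundaryOp.exists_linear_solution (B : BoundaryOp) {κ : ℝ} (hκ : |B.slope| < κ) :
    ∃ ψ ψ' : ℝ → ℝ, (∀ x, HasDerivAt ψ (ψ' x) x) ∧ (∀ x, HasDerivAt ψ' (κ ^ 2 * ψ x) x) ∧
      B.apply (ψ 0) (ψ' 0) = 0 ∧ 0 ≤ ψ 0 ∧ (ψ 0 = 0 → 0 ≤ ψ' 0) ∧ ∀ x > 0, 0 < ψ x := by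
  have hκ0 : 0 < κ := (abs_nonneg _).trans_lt hκ
  have hs : ∀ x, HasDerivAt (fun x => Real.sinh (κ * x)) (κ * Real.cosh (κ * x)) x := fun x => by
    simpa [mul_comm] using ((hasDerivAt_id x).const_mul κ).sinh
  have hc : ∀ x, HasDerivAt (fun x => Real.cosh (κ * x)) (κ * Real.sinh (κ * x)) x := fun x => by
    simpa [mul_comm] using ((hasDerivAt_id x).const_mul κ).cosh
  have hder : ∀ A σ : ℝ,
      (∀ x, HasDerivAt (fun x => A * Real.cosh (κ * x) + σ * Real.sinh (κ * x))
        (A * (κ * Real.sinh (κ * x)) + σ * (κ * Real.cosh (κ * x))) x) ∧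
      (∀ x, HasDerivAt (fun x => A * (κ * Real.sinh (κ * x)) + σ * (κ * Real.cosh (κ * x)))
        (κ ^ 2 * (A * Real.cosh (κ * x) + σ * Real.sinh (κ * x))) x) := fun A σ =>
    ⟨fun x => ((hc x).const_mul A).add ((hs x).const_mul σ), fun x =>
      ((((hs x).const_mul κ).const_mul A).add (((hc x).const_mul κ).const_mul σ)).congr_deriv
        (by ring)⟩
  by_cases hB : B = .dirichlet
  · subst hB
    refine ⟨_, _, (hder 0 1).1, (hder 0 1).2, ?_, ?_, ?_, ?_⟩
    · simp [BoundaryOp.apply]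
    · simp
    · simp [hκ0.le]
    · intro x hx
      simpa using mul_pos hκ0 hx
  · refine ⟨_, _, (hder 1 (B.slope / κ)).1, (hder 1 (B.slope / κ)).2, ?_, ?_, ?_, ?_⟩
    · rw [BoundaryOp.apply_eq_zero_iff hB]
      simp [hκ0.ne']
    · simp
    · simp
    · intro x hx
      have h1 : 0 < Real.sinh (κ * x) := Real.sinh_pos_iff.2 (mul_pos hκ0 hx)
      have h2 : Real.sinh (κ * x) < Real.cosh (κ * x) := Real.sinh_lt_cosh _
      have h3 : -1 < B.slope / κ := by
        rw [lt_div_iff₀ hκ0]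
        linarith [(abs_lt.1 hκ).1]
      nlinarith

/-- The maximum principle for `-w'' + κ² w ≥ 0`, in a quantitative form: the quotient of `w` by the
solution `ψ` of the homogeneous equation is nonincreasing. -/
lemma linear_lower_bound {b κ : ℝ} {ψ ψ' w w' w'' : ℝ → ℝ} (hb : 0 < b)
    (hψ : ∀ x, HasDerivAt ψ (ψ' x) x) (hψ' : ∀ x, HasDerivAt ψ' (κ ^ 2 * ψ x) x)
    (hψpos : ∀ x > 0, 0 < ψ x) (hw : HasTwoDerivsOn (Icc 0 b) w w' w'')
    (hineq : ∀ x ∈ Icc 0 b, w'' x ≤ κ ^ 2 * w x) (hZ : 0 ≤ ψ' 0 * w 0 - ψ 0 * w' 0) :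
    ∀ x ∈ Ioc 0 b, ψ x / ψ b * w b ≤ w x := by
  intro x hx
  have hneg : HasTwoDerivsOn (Icc 0 b) (fun x => -w x) (fun x => -w' x) (fun x => -w'' x) :=
    fun y hy => ⟨(hw y hy).1.neg, (hw y hy).2.neg⟩
  have hψd : HasTwoDerivsOn (Icc 0 b) ψ ψ' (fun x => κ ^ 2 * ψ x) :=
    .of_forall (fun y _ => hψ y) (fun y _ => hψ' y)
  have hbp := hψpos b hb
  have hxp := hψpos x hx.1
  have := hneg.div_le_div_of_wronskian hψd (fun y hy => ?_) ?_ hx.1.le hx.2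
    (fun y hy => hψpos y (hx.1.trans_le hy.1))
  · rw [div_le_div_iff₀ hxp hbp] at this
    rw [div_mul_eq_mul_div, div_le_iff₀ hbp]
    linarith
  · have h1 := hineq y (Ioo_subset_Icc_self hy)
    nlinarith [hψpos y hy.1]
  · linarith

lemma linear_nonneg {b κ : ℝ} {ψ ψ' w w' w'' : ℝ → ℝ} (hb : 0 < b)
    (hψ : ∀ x, HasDerivAt ψ (ψ' x) x) (hψ' : ∀ x, HasDerivAt ψ' (κ ^ 2 * ψ x) x)
    (hψpos : ∀ x > 0, 0 < ψ x) (hw : HasTwoDerivsOn (Icc 0 b) w w' w'')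
    (hineq : ∀ x ∈ Icc 0 b, w'' x ≤ κ ^ 2 * w x) (hZ : 0 ≤ ψ' 0 * w 0 - ψ 0 * w' 0)
    (hwb : 0 ≤ w b) : ∀ x ∈ Icc 0 b, 0 ≤ w x := by
  have h1 : ∀ x ∈ Ioc 0 b, 0 ≤ w x := fun x hx =>
    (mul_nonneg (div_nonneg (hψpos x hx.1).le (hψpos b hb).le) hwb).trans
      (linear_lower_bound hb hψ hψ' hψpos hw hineq hZ x hx)
  intro x hx
  rcases hx.1.eq_or_lt with rfl | h0
  · have hle : 𝓝[>] (0 : ℝ) ≤ 𝓝[Icc 0 b] 0 :=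
      nhdsWithin_le_iff.2 (mem_of_superset (Ioo_mem_nhdsGT hb) Ioo_subset_Icc_self)
    refine ge_of_tendsto ((hw.continuousOn 0 hx).mono_left hle) ?_
    filter_upwards [Ioo_mem_nhdsGT hb] with y hy using h1 y (Ioo_subset_Ioc_self hy)
  · exact h1 x ⟨h0, hx.2⟩

/-- The linear boundary value problem `-u'' + κ² u = h`, `𝓑u(0) = 0`, `u(b) = M` is solved by
variation of constants. Continuity of `h` is assumed inside the existential quantifier, so that a
solution operator on all functions `h` can be chosen. -/
lemma BoundaryOp.exists_linear_bvp (B : BoundaryOp) {κ b : ℝ} (hκ : |B.slope| < κ) (hb : 0 < b)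
    (M : ℝ) (h : ℝ → ℝ) :
    ∃ u u' : ℝ → ℝ, ContinuousOn h (Icc 0 b) →
      HasTwoDerivsOn (Icc 0 b) u u' (fun x => κ ^ 2 * u x - h x) ∧
      B.apply (u 0) (u' 0) = 0 ∧ u b = M := by
  by_cases hh : ContinuousOn h (Icc 0 b)
  swap
  · exact ⟨0, 0, fun hh' => absurd hh' hh⟩
  obtain ⟨H, hH, hHh⟩ := continuous_IccExtend_of_continuousOn hb.le hh
  obtain ⟨ψ, ψ', hψ, hψ', hB, -, -, hpos⟩ := B.exists_linear_solution hκ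
  have hκ0 : 0 < κ := (abs_nonneg _).trans_lt hκ
  have hs : ∀ x, HasDerivAt (fun x => Real.sinh (κ * x)) (κ * Real.cosh (κ * x)) x := fun x => by
    simpa [mul_comm] using ((hasDerivAt_id x).const_mul κ).sinh
  have hc : ∀ x, HasDerivAt (fun x => Real.cosh (κ * x)) (κ * Real.sinh (κ * x)) x := fun x => by
    simpa [mul_comm] using ((hasDerivAt_id x).const_mul κ).cosh
  let S : ℝ → ℝ := fun x => ∫ t in (0 : ℝ)..x, Real.sinh (κ * t) * H t
  let C : ℝ → ℝ := fun x => ∫ t in (0 : ℝ)..x, Real.cosh (κ * t) * H t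
  have hS : ∀ x, HasDerivAt S (Real.sinh (κ * x) * H x) x := fun x =>
    Continuous.hasDerivAt_primitive
      ((Real.continuous_sinh.comp (continuous_const.mul continuous_id)).mul hH) x
  have hC : ∀ x, HasDerivAt C (Real.cosh (κ * x) * H x) x := fun x =>
    Continuous.hasDerivAt_primitive
      ((Real.continuous_cosh.comp (continuous_const.mul continuous_id)).mul hH) x
  -- the solution with zero Cauchy data at `0`
  let y : ℝ → ℝ := fun x => (Real.cosh (κ * x) * S x - Real.sinh (κ * x) * C x) / κ
  let y' : ℝ → ℝ := fun x => Real.sinh (κ * x) * S x - Real.cosh (κ * x) * C x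
  have hy : ∀ x, HasDerivAt y (y' x) x := fun x => by
    refine ((((hc x).mul (hS x)).sub ((hs x).mul (hC x))).div_const κ).congr_deriv ?_
    simp only [y']
    field_simp
    ring
  have hy' : ∀ x, HasDerivAt y' (κ ^ 2 * y x - H x) x := fun x => by
    refine (((hs x).mul (hS x)).sub ((hc x).mul (hC x))).congr_deriv ?_
    have := Real.cosh_sq (κ * x)
    simp only [y]
    field_simp
    linear_combination (-H x) * this
  have hy0 : y 0 = 0 := by simp [y, S]
  have hy'0 : y' 0 = 0 := by simp [y', C]
  have hψb := hpos b hb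
  let k := (M - y b) / ψ b
  refine ⟨fun x => k * ψ x + y x, fun x => k * ψ' x + y' x, fun _ => ⟨fun x hx => ⟨?_, ?_⟩, ?_, ?_⟩⟩
  · exact (((hψ x).const_mul k).add (hy x)).hasDerivWithinAt
  · refine (((hψ' x).const_mul k).add (hy' x)).hasDerivWithinAt.congr_deriv ?_
    rw [hHh hx]
    ring
  · simp only [hy0, hy'0, add_zero]
    by_cases hD : B = .dirichlet
    · subst hD
      simp only [BoundaryOp.apply] at hB ⊢
      simp [hB]
    · rw [BoundaryOp.apply_eq_zero_iff hD] at hB ⊢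
      rw [hB]
      ring
  · simp only [k]
    field_simp
    ring

/-- Taylor's formula of order two with integral remainder. -/
lemma HasTwoDerivsOn.taylor {b : ℝ} {u u' g : ℝ → ℝ} (h : HasTwoDerivsOn (Icc 0 b) u u' g)
    (hg : ContinuousOn g (Icc 0 b)) {x : ℝ} (hx : x ∈ Icc 0 b) :
    u x = u 0 + u' 0 * x + ∫ t in (0 : ℝ)..x, (x - t) * g t := by
  have hsub : Icc 0 x ⊆ Icc 0 b := Icc_subset_Icc_right hx.2
  have h2 := h.mono hsub
  have hd : ∀ t ∈ Icc 0 x, HasDerivWithinAt (fun t => u t + (x - t) * u' t) ((x - t) * g t)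
      (Icc 0 x) t := fun t ht => by
    have h1 : HasDerivWithinAt (fun t : ℝ => x - t) (-1) (Icc 0 x) t :=
      (hasDerivWithinAt_id t _).const_sub x
    refine ((h2 t ht).1.add (h1.mul (h2 t ht).2)).congr_deriv ?_
    ring
  have hcont : ContinuousOn (fun t => (x - t) * g t) (Icc 0 x) :=
    (continuousOn_const.sub continuousOn_id).mul (hg.mono hsub)
  have := intervalIntegral.integral_eq_sub_of_hasDerivAt_of_le hx.1
    (fun t ht => (hd t ht).continuousWithinAt)
    (fun t ht => (hd t (Ioo_subset_Icc_self ht)).hasDerivAt (Icc_mem_nhds ht.1 ht.2))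
    (hcont.intervalIntegrable_of_Icc hx.1)
  rw [this]
  ring

/-- Pointwise limits of functions whose second derivatives converge boundedly. The derivatives
`u' n 0` at the left endpoint converge as well, and the limit `U` is continuous; hence `U` is twice
differentiable with second derivative `lim g n` if that limit is continuous. -/
lemma exists_limit_of_tendsto {b C : ℝ} (hb : 0 < b) {u u' g : ℕ → ℝ → ℝ} {U G : ℝ → ℝ}
    (h : ∀ᶠ n in atTop, HasTwoDerivsOn (Icc 0 b) (u n) (u' n) (g n))
    (hgc : ∀ᶠ n in atTop, ContinuousOn (g n) (Icc 0 b))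
    (hgC : ∀ᶠ n in atTop, ∀ x ∈ Icc 0 b, |g n x| ≤ C)
    (hu : ∀ x ∈ Icc 0 b, Tendsto (fun n => u n x) atTop (𝓝 (U x)))
    (hg : ∀ x ∈ Icc 0 b, Tendsto (fun n => g n x) atTop (𝓝 (G x))) :
    ∃ d, Tendsto (fun n => u' n 0) atTop (𝓝 d) ∧ ContinuousOn U (Icc 0 b) ∧
      (ContinuousOn G (Icc 0 b) →
        HasTwoDerivsOn (Icc 0 b) U (fun x => d + ∫ t in (0 : ℝ)..x, G t) G) := by
  have h0 : (0 : ℝ) ∈ Icc 0 b := ⟨le_rfl, hb.le⟩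
  have hI : ∀ x ∈ Icc 0 b, Tendsto (fun n => ∫ t in (0 : ℝ)..x, (x - t) * g n t) atTop
      (𝓝 (∫ t in (0 : ℝ)..x, (x - t) * G t)) := by
    intro x hx
    have hmem : ∀ t ∈ uIoc 0 x, t ∈ Icc 0 b := fun t ht => by
      rw [uIoc_of_le hx.1] at ht
      exact ⟨ht.1.le, ht.2.trans hx.2⟩
    refine intervalIntegral.tendsto_integral_filter_of_dominated_convergence (fun _ => b * C)
      ?_ ?_ intervalIntegrable_const ?_
    · filter_upwards [hgc] with n hn
      refine ContinuousOn.aestronglyMeasurable ?_ measurableSet_uIoc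
      exact (continuousOn_const.sub continuousOn_id).mul (hn.mono hmem)
    · filter_upwards [hgC] with n hn
      refine Eventually.of_forall fun t ht => ?_
      have h1 := hn t (hmem t ht)
      rw [uIoc_of_le hx.1] at ht
      rw [Real.norm_eq_abs, abs_mul]
      refine mul_le_mul ?_ h1 (abs_nonneg _) hb.le
      rw [abs_of_nonneg (by linarith [ht.2])]
      linarith [ht.1, hx.2]
    · exact Eventually.of_forall fun t ht => (hg t (hmem t ht)).const_mul _
  have htaylor : ∀ x ∈ Icc 0 b, ∀ᶠ n in atTop,
      u n x = u n 0 + u' n 0 * x + ∫ t in (0 : ℝ)..x, (x - t) * g n t := fun x hx => by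
    filter_upwards [h, hgc] with n hn1 hn2 using hn1.taylor hn2 hx
  obtain ⟨d, hd⟩ : ∃ d, Tendsto (fun n => u' n 0) atTop (𝓝 d) := by
    have hbm : b ∈ Icc 0 b := ⟨hb.le, le_rfl⟩
    refine ⟨_, ((((hu b hbm).sub (hu 0 h0)).sub (hI b hbm)).div_const b).congr' ?_⟩
    filter_upwards [htaylor b hbm] with n hn
    rw [hn]
    field_simp
    ring
  have hUeq : ∀ x ∈ Icc 0 b, U x = U 0 + d * x + ∫ t in (0 : ℝ)..x, (x - t) * G t := by
    intro x hx
    refine tendsto_nhds_unique (hu x hx) ?_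
    refine (((hu 0 h0).add (hd.mul_const x)).add (hI x hx)).congr' ?_
    filter_upwards [htaylor x hx] with n hn using hn.symm
  refine ⟨d, hd, ?_, fun hG => ?_⟩
  · -- the `u n` are equi-Lipschitz, since their first derivatives are bounded
    have hlip : ∀ x ∈ Icc 0 b, ∀ y ∈ Icc 0 b, ‖U y - U x‖ ≤ (|d| + 1 + C * b) * ‖y - x‖ := by
      intro x hx y hy
      refine le_of_tendsto (((hu y hy).sub (hu x hx)).norm) ?_
      filter_upwards [h, hgC, hd.abs.eventually_le_const (lt_add_one |d|)] with n hn1 hn2 hn3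
      refine (convex_Icc 0 b).norm_image_sub_le_of_norm_hasDerivWithin_le
        (fun z hz => (hn1 z hz).1) (fun z hz => ?_) hx hy
      have h1 := (convex_Icc 0 b).norm_image_sub_le_of_norm_hasDerivWithin_le
        (fun z hz => (hn1 z hz).2) hn2 h0 hz
      have h2 : C * ‖z - 0‖ ≤ C * b := by
        refine mul_le_mul_of_nonneg_left ?_ ((abs_nonneg _).trans (hn2 0 h0))
        rw [sub_zero, Real.norm_eq_abs, abs_of_nonneg hz.1]
        exact hz.2
      calc ‖u' n z‖ = ‖u' n 0 + (u' n z - u' n 0)‖ := by ring_nf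
        _ ≤ ‖u' n 0‖ + ‖u' n z - u' n 0‖ := norm_add_le _ _
        _ ≤ _ := by
          simp only [Real.norm_eq_abs] at h1 h2 hn3 ⊢
          linarith
    have hL : LipschitzOnWith (Real.toNNReal (|d| + 1 + C * b)) U (Icc 0 b) := by
      refine LipschitzOnWith.of_dist_le_mul fun y hy x hx => ?_
      rw [dist_eq_norm, dist_eq_norm]
      exact (hlip x hx y hy).trans
        (mul_le_mul_of_nonneg_right (Real.le_coe_toNNReal _) (norm_nonneg _))
    exact hL.continuousOn
  · obtain ⟨H, hH, hHG⟩ := continuous_IccExtend_of_continuousOn hb.le hG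
    have hcongr : ∀ x ∈ Icc 0 b, ∀ t ∈ uIcc 0 x, H t = G t := fun x hx t ht => by
      rw [uIcc_of_le hx.1] at ht
      exact hHG ⟨ht.1, ht.2.trans hx.2⟩
    have hU' : ∀ x ∈ Icc 0 b, d + ∫ t in (0 : ℝ)..x, G t = d + ∫ t in (0 : ℝ)..x, H t :=
      fun x hx => by
        rw [intervalIntegral.integral_congr (g := H) fun t ht => (hcongr x hx t ht).symm]
    have hHt : Continuous fun t => t * H t := continuous_id.mul hH
    have hU : ∀ x ∈ Icc 0 b, U x = U 0 + d * x +
        (x * (∫ t in (0 : ℝ)..x, H t) - ∫ t in (0 : ℝ)..x, t * H t) := fun x hx => by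
      have hHx : Continuous fun t => x * H t := continuous_const.mul hH
      rw [hUeq x hx, ← intervalIntegral.integral_const_mul, ← intervalIntegral.integral_sub
        (hHx.intervalIntegrable _ _) (hHt.intervalIntegrable _ _)]
      congr 1
      refine intervalIntegral.integral_congr fun t ht => ?_
      simp only [hcongr x hx t ht]
      ring
    intro x hx
    refine ⟨?_, ?_⟩
    · refine HasDerivWithinAt.congr ?_ hU (hU x hx)
      have h1 := ((hasDerivAt_id x).mul (hH.hasDerivAt_primitive x)).sub (hHt.hasDerivAt_primitive x)
      have h2 := (((hasDerivAt_id x).const_mul d).const_add (U 0)).add h1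
      refine h2.hasDerivWithinAt.congr_deriv ?_
      simp only [id, hU' x hx]
      ring
    · refine HasDerivWithinAt.congr ?_ hU' (hU' x hx)
      rw [← hHG hx]
      exact ((hH.hasDerivAt_primitive x).const_add d).hasDerivWithinAt

/-! ### Finite boundary values and the blow-up barrier -/

lemma exists_le_mul_rpow {p a₀ : ℝ} (hp : 1 < p) (ha₀ : 0 < a₀) (K M : ℝ) :
    ∃ Q, 0 < Q ∧ M ≤ Q ∧ K ≤ a₀ * Q ^ (p - 1) := by
  have h1 := (tendsto_rpow_atTop (by linarith : 0 < p - 1)).const_mul_atTop ha₀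
  obtain ⟨Q, hQ1, hQ2, hQ3⟩ := ((eventually_gt_atTop 0).and ((eventually_ge_atTop M).and
    (h1.eventually_ge_atTop K))).exists
  exact ⟨Q, hQ1, hQ2, hQ3⟩

lemma abs_rpow_mul_sub_le {p z w P : ℝ} (hp : 1 < p) (hz : 0 ≤ z) (hzw : z ≤ w) (hwP : w ≤ P) :
    |w| ^ (p - 1) * w - |z| ^ (p - 1) * z ≤ p * P ^ (p - 1) * (w - z) := by
  have hw := hz.trans hzw
  have heq : ∀ x : ℝ, 0 ≤ x → |x| ^ (p - 1) * x = x ^ p := fun x hx => by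
    rw [abs_of_nonneg hx, ← Real.rpow_add_one' hx (by linarith)]
    ring_nf
  rw [heq w hw, heq z hz]
  refine (convex_Icc 0 P).image_sub_le_mul_sub_of_deriv_le
    (Real.continuous_rpow_const (by linarith)).continuousOn
    (Real.differentiable_rpow_const hp.le).differentiableOn (fun x hx => ?_)
    z ⟨hz, hzw.trans hwP⟩ w ⟨hw, hwP⟩ hzw
  rw [interior_Icc] at hx
  rw [Real.deriv_rpow_const]
  exact mul_le_mul_of_nonneg_left (Real.rpow_le_rpow hx.1.le hx.2.le (by linarith)) (by linarith)

/-- The boundary value problem with a finite value `M > 0` at the right endpoint has a positive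
solution. It is the limit of the monotone iteration starting at the subsolution `0`, bounded from
above by a supersolution `N exp(β x)`. -/
theorem exists_finite_solution {p b l M : ℝ} {a : ℝ → ℝ} (B : BoundaryOp) (hp : 1 < p) (hb : 0 < b)
    (ha : ContinuousOn a (Icc 0 b)) (ha_pos : ∀ x ∈ Icc 0 b, 0 < a x) (hM : 0 < M) :
    ∃ u u' : ℝ → ℝ, IsSolOn (Icc 0 b) p a B l u u' ∧ u b = M := by
  have hbm : b ∈ Icc 0 b := ⟨hb.le, le_rfl⟩
  obtain ⟨x₀, hx₀, hmin⟩ := isCompact_Icc.exists_isMinOn ⟨b, hbm⟩ ha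
  obtain ⟨x₁, hx₁, hmax⟩ := isCompact_Icc.exists_isMaxOn ⟨b, hbm⟩ ha
  have hmin : ∀ x ∈ Icc 0 b, a x₀ ≤ a x := fun x hx => hmin hx
  have hmax : ∀ x ∈ Icc 0 b, a x ≤ a x₁ := fun x hx => hmax hx
  have ha₀ := ha_pos x₀ hx₀
  have ha₁ := ha_pos x₁ hx₁
  set β := B.slope with hβ
  obtain ⟨Q, hQ, hMQ, hKQ⟩ := exists_le_mul_rpow hp ha₀ (β ^ 2 + l) M
  -- the supersolution `Φ`, with values in `[Q, P]`
  let Φ : ℝ → ℝ := fun x => Q * Real.exp (|β| * b) * Real.exp (β * x)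
  let P := Q * Real.exp (|β| * b) * Real.exp (|β| * b)
  have hP : 0 < P := by positivity
  have hexp : ∀ x, HasDerivAt (fun x => Real.exp (β * x)) (β * Real.exp (β * x)) x := fun x => by
    simpa [mul_comm] using ((hasDerivAt_id x).const_mul β).exp
  have hΦ : HasTwoDerivsOn (Icc 0 b) Φ (fun x => β * Φ x) (fun x => β ^ 2 * Φ x) := by
    have h1 : ∀ x, HasDerivAt Φ (β * Φ x) x := fun x =>
      ((hexp x).const_mul _).congr_deriv (by simp only [Φ]; ring)
    exact .of_forall (fun x _ => h1 x)
      (fun x _ => ((h1 x).const_mul β).congr_deriv (by ring))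
  have hβx : ∀ x ∈ Icc 0 b, |β * x| ≤ |β| * b := fun x hx => by
    rw [abs_mul, abs_of_nonneg hx.1]
    exact mul_le_mul_of_nonneg_left hx.2 (abs_nonneg _)
  have hΦQ : ∀ x ∈ Icc 0 b, Q ≤ Φ x := fun x hx => by
    simp only [Φ]
    rw [mul_assoc, ← Real.exp_add]
    refine le_mul_of_one_le_right hQ.le (Real.one_le_exp ?_)
    linarith [(abs_le.1 (hβx x hx)).1]
  have hΦP : ∀ x ∈ Icc 0 b, Φ x ≤ P := fun x hx => by
    refine mul_le_mul_of_nonneg_left (Real.exp_le_exp.2 ?_) (by positivity)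
    exact (abs_le.1 (hβx x hx)).2
  have hΦsuper : ∀ x ∈ Icc 0 b, β ^ 2 * Φ x ≤ a x * (|Φ x| ^ (p - 1) * Φ x) - l * Φ x := by
    intro x hx
    have hpos : 0 < Φ x := hQ.trans_le (hΦQ x hx)
    have h1 : a x₀ * Q ^ (p - 1) ≤ a x * |Φ x| ^ (p - 1) := by
      rw [abs_of_pos hpos]
      exact mul_le_mul (hmin x hx) (Real.rpow_le_rpow hQ.le (hΦQ x hx) (by linarith))
        (by positivity) (ha_pos x hx).le
    nlinarith
  -- the shift `κ²` makes `h` nondecreasing in its second argument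
  obtain ⟨κ, hκβ, hκ⟩ : ∃ κ : ℝ, |β| < κ ∧ a x₁ * (p * P ^ (p - 1)) ≤ κ ^ 2 + l := by
    have h1 : Tendsto (fun κ : ℝ => κ ^ 2 + l) atTop atTop :=
      tendsto_atTop_add_const_right _ _ (tendsto_pow_atTop two_ne_zero)
    exact ((eventually_gt_atTop |β|).and (h1.eventually_ge_atTop _)).exists
  let h : ℝ → ℝ → ℝ := fun x w => (κ ^ 2 + l) * w - a x * (|w| ^ (p - 1) * w)
  have hmono : ∀ x ∈ Icc 0 b, ∀ z w, 0 ≤ z → z ≤ w → w ≤ P → h x z ≤ h x w := by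
    intro x hx z w hz hzw hwP
    have h1 := mul_le_mul_of_nonneg_left (abs_rpow_mul_sub_le hp hz hzw hwP) (ha_pos x hx).le
    have h2 : a x * (p * P ^ (p - 1) * (w - z)) ≤ (κ ^ 2 + l) * (w - z) := by
      rw [← mul_assoc]
      refine mul_le_mul_of_nonneg_right (le_trans ?_ hκ) (sub_nonneg.2 hzw)
      exact mul_le_mul_of_nonneg_right (hmax x hx) (by positivity)
    simp only [h]
    nlinarith
  have h_zero : ∀ x, h x 0 = 0 := fun x => by simp [h]
  have hhΦ : ∀ x ∈ Icc 0 b, h x (Φ x) ≤ κ ^ 2 * Φ x - β ^ 2 * Φ x := fun x hx => by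
    simp only [h]
    linarith [hΦsuper x hx]
  have hhcont : ∀ w : ℝ → ℝ, ContinuousOn w (Icc 0 b) →
      ContinuousOn (fun x => h x (w x)) (Icc 0 b) := fun w hw =>
    (continuousOn_const.mul hw).sub (ha.mul ((continuous_abs_rpow_mul hp).comp_continuousOn hw))
  obtain ⟨ψ, ψ', hψ, hψ', hψB, hψ0, hψ'0, hψpos⟩ := B.exists_linear_solution hκβ
  choose T T' hT using fun g : ℝ → ℝ => B.exists_linear_bvp hκβ hb M g
  let S : (ℝ → ℝ) → ℝ → ℝ := fun w => T fun x => h x (w x)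
  let S' : (ℝ → ℝ) → ℝ → ℝ := fun w => T' fun x => h x (w x)
  have hS : ∀ w, ContinuousOn w (Icc 0 b) →
      HasTwoDerivsOn (Icc 0 b) (S w) (S' w) (fun x => κ ^ 2 * S w x - h x (w x)) ∧
      B.apply (S w 0) (S' w 0) = 0 ∧ S w b = M := fun w hw => hT _ (hhcont w hw)
  let I : (ℝ → ℝ) → Prop := fun w =>
    ContinuousOn w (Icc 0 b) ∧ ∀ x ∈ Icc 0 b, 0 ≤ w x ∧ w x ≤ Φ x
  have hI0 : I 0 := ⟨continuousOn_const, fun x hx => ⟨le_rfl, hQ.le.trans (hΦQ x hx)⟩⟩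
  have hh0 : ∀ w, I w → ∀ x ∈ Icc 0 b, 0 ≤ h x (w x) := fun w hw x hx => by
    have := hmono x hx 0 (w x) le_rfl (hw.2 x hx).1 ((hw.2 x hx).2.trans (hΦP x hx))
    rwa [h_zero] at this
  have hhle : ∀ w, I w → ∀ x ∈ Icc 0 b, h x (w x) ≤ κ ^ 2 * Φ x - β ^ 2 * Φ x := fun w hw x hx =>
    (hmono x hx _ _ (hw.2 x hx).1 (hw.2 x hx).2 (hΦP x hx)).trans (hhΦ x hx)
  have hIS : ∀ w, I w → I (S w) := by
    intro w hw
    obtain ⟨hd, hB, hSb⟩ := hS w hw.1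
    refine ⟨hd.continuousOn, fun x hx => ⟨?_, ?_⟩⟩
    · refine linear_nonneg hb hψ hψ' hψpos hd (fun y hy => ?_) ?_ ?_ x hx
      · linarith [hh0 w hw y hy]
      · rw [B.wronskian_eq_zero hB hψB]
      · rw [hSb]
        exact hM.le
    · refine sub_nonneg.1 (linear_nonneg hb hψ hψ' hψpos (hΦ.sub hd) (fun y hy => ?_) ?_ ?_ x hx)
      · linarith [hhle w hw y hy]
      · have h1 := B.wronskian_nonneg (u₀ := Φ 0) (u₁ := β * Φ 0) hψB hψ0 hψ'0
          (hQ.le.trans (hΦQ 0 ⟨le_rfl, hb.le⟩)) le_rfl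
        have h2 := B.wronskian_eq_zero hB hψB
        linarith
      · rw [hSb]
        linarith [hΦQ b hbm]
  have hSmono : ∀ w z, I w → I z → (∀ x ∈ Icc 0 b, w x ≤ z x) → ∀ x ∈ Icc 0 b, S w x ≤ S z x := by
    intro w z hw hz hwz x hx
    obtain ⟨hd, hB, hSb⟩ := hS w hw.1
    obtain ⟨hd₂, hB₂, hSb₂⟩ := hS z hz.1
    refine sub_nonneg.1 (linear_nonneg hb hψ hψ' hψpos (hd₂.sub hd) (fun y hy => ?_) ?_ ?_ x hx)
    · linarith [hmono y hy _ _ (hw.2 y hy).1 (hwz y hy) ((hz.2 y hy).2.trans (hΦP y hy))]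
    · have h1 := B.wronskian_eq_zero hB hψB
      have h2 := B.wronskian_eq_zero hB₂ hψB
      linarith
    · rw [hSb, hSb₂, sub_self]
  let u : ℕ → ℝ → ℝ := fun n => S^[n] 0
  have hu_succ : ∀ n, u (n + 1) = S (u n) := fun n => Function.iterate_succ_apply' S n 0
  have hIu : ∀ n, I (u n) := fun n => by
    induction n with
    | zero => exact hI0
    | succ n ih => rw [hu_succ]; exact hIS _ ih
  have hu_le : ∀ n, ∀ x ∈ Icc 0 b, u n x ≤ u (n + 1) x := fun n => by
    induction n with
    | zero => exact fun x hx => ((hIu 1).2 x hx).1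
    | succ n ih =>
      rw [hu_succ n, hu_succ (n + 1)]
      exact hSmono _ _ (hIu n) (hIu (n + 1)) ih
  have hu_mono : ∀ x ∈ Icc 0 b, Monotone fun n => u n x := fun x hx =>
    monotone_nat_of_le_succ fun n => hu_le n x hx
  have hbdd : ∀ x ∈ Icc 0 b, BddAbove (range fun n => u n x) := fun x hx =>
    ⟨Φ x, by rintro _ ⟨n, rfl⟩; exact ((hIu n).2 x hx).2⟩
  let U : ℝ → ℝ := fun x => ⨆ n, u n x
  have hlim : ∀ x ∈ Icc 0 b, Tendsto (fun n => u n x) atTop (𝓝 (U x)) := fun x hx =>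
    tendsto_atTop_ciSup (hu_mono x hx) (hbdd x hx)
  have hlim1 : ∀ x ∈ Icc 0 b, Tendsto (fun n => u (n + 1) x) atTop (𝓝 (U x)) := fun x hx =>
    (hlim x hx).comp (tendsto_add_atTop_nat 1)
  have hder : ∀ n, HasTwoDerivsOn (Icc 0 b) (u (n + 1)) (S' (u n))
      (fun x => κ ^ 2 * u (n + 1) x - h x (u n x)) := fun n => by
    rw [hu_succ]
    exact (hS _ (hIu n).1).1
  obtain ⟨d, hd, hUc, hUd⟩ := exists_limit_of_tendsto (C := κ ^ 2 * P)
    (G := fun x => κ ^ 2 * U x - h x (U x)) hb (Eventually.of_forall hder)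
    (Eventually.of_forall fun n =>
      (continuousOn_const.mul (hIu (n + 1)).1).sub (hhcont _ (hIu n).1))
    (Eventually.of_forall fun n x hx => by
      have h1 := (hIu (n + 1)).2 x hx
      have h2 := hh0 _ (hIu n) x hx
      have h3 := hhle _ (hIu n) x hx
      have h4 := hΦP x hx
      have h5 := hQ.le.trans (hΦQ x hx)
      have h6 : 0 ≤ β ^ 2 * Φ x := by positivity
      have h7 : κ ^ 2 * Φ x ≤ κ ^ 2 * P := mul_le_mul_of_nonneg_left h4 (sq_nonneg κ)
      have h8 : κ ^ 2 * u (n + 1) x ≤ κ ^ 2 * Φ x := mul_le_mul_of_nonneg_left h1.2 (sq_nonneg κ)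
      have h9 : 0 ≤ κ ^ 2 * u (n + 1) x := mul_nonneg (sq_nonneg κ) h1.1
      rw [abs_le]
      constructor <;> linarith) hlim1
    (fun x hx => ((hlim1 x hx).const_mul _).sub (((hlim x hx).const_mul _).sub
      ((((continuous_abs_rpow_mul hp).tendsto _).comp (hlim x hx)).const_mul _)))
  have hG : (fun x => κ ^ 2 * U x - h x (U x)) =
      fun x => a x * (|U x| ^ (p - 1) * U x) - l * U x := by
    funext x
    simp only [h]
    ring
  refine ⟨U, fun x => d + ∫ t in (0 : ℝ)..x, κ ^ 2 * U t - h t (U t),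
    ⟨?_, fun x hx hx0 => ?_, ?_⟩, ?_⟩
  · rw [← hG]
    exact hUd ((continuousOn_const.mul hUc).sub (hhcont U hUc))
  · -- the first iterate solves the homogeneous linear equation and is therefore positive
    obtain ⟨hd₁, hB₁, hSb₁⟩ := hS 0 hI0.1
    have h1 := linear_lower_bound hb hψ hψ' hψpos hd₁ (fun y hy => by simp [h_zero])
      (by rw [B.wronskian_eq_zero hB₁ hψB]) x ⟨hx0, hx.2⟩
    rw [hSb₁] at h1
    have h2 : 0 < ψ x / ψ b * M := mul_pos (div_pos (hψpos x hx0) (hψpos b hb)) hM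
    exact (h2.trans_le h1).trans_le (le_ciSup (hbdd x hx) 1)
  · simp only [intervalIntegral.integral_same, add_zero]
    refine tendsto_nhds_unique (B.tendsto_apply (hlim1 0 ⟨le_rfl, hb.le⟩) hd) ?_
    refine tendsto_const_nhds.congr fun n => ?_
    rw [hu_succ]
    exact (hS _ (hIu n).1).2.1.symm
  · refine tendsto_nhds_unique (hlim1 b hbm) (tendsto_const_nhds.congr fun n => ?_)
    rw [hu_succ]
    exact (hS _ (hIu n).1).2.2.symm

/-- A supersolution `A exp(-γ x) (b - x)^(-2/(p-1))` that blows up at `b` (the Keller-Osserman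
bound). -/
theorem exists_barrier {p b a₀ : ℝ} (B : BoundaryOp) (hp : 1 < p) (hb : 0 < b) (ha₀ : 0 < a₀)
    (l : ℝ) :
    ∃ Φ Φ' Φ'' : ℝ → ℝ, HasTwoDerivsOn (Ico 0 b) Φ Φ' Φ'' ∧ (∀ x ∈ Ico 0 b, 0 < Φ x) ∧
      (∀ x ∈ Ico 0 b, Φ'' x ≤ a₀ * (|Φ x| ^ (p - 1) * Φ x) - l * Φ x) ∧
      Φ' 0 ≤ B.slope * Φ 0 ∧ Tendsto Φ (𝓝[<] b) atTop := by
  set β := B.slope with hβ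
  have hp' : 0 < p - 1 := by linarith
  set α := 2 / (p - 1) with hα
  have hα0 : 0 < α := by positivity
  -- this choice makes `Φ'(0) = -|β| Φ(0)`
  set γ := α / b + |β| with hγ
  have hγ0 : 0 < γ := by positivity
  obtain ⟨Q, hQ, -, hKQ⟩ := exists_le_mul_rpow hp ha₀
    (2 * γ ^ 2 * b ^ 2 + 2 * α ^ 2 + α + |l| * b ^ 2) 0
  -- `q` is the logarithmic derivative of `Φ`
  let Φ : ℝ → ℝ := fun x => Q * Real.exp (γ * (b - x)) * (b - x) ^ (-α)
  let q : ℝ → ℝ := fun x => -γ + α / (b - x)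
  have hpos : ∀ x ∈ Ico 0 b, 0 < Φ x := fun x hx => by
    have := Real.rpow_pos_of_pos (sub_pos.2 hx.2) (-α)
    positivity
  have hΦ : ∀ x ∈ Ico 0 b, HasDerivAt Φ (Φ x * q x) x := fun x hx => by
    have hy := sub_pos.2 hx.2
    have h1 : HasDerivAt (fun x => b - x) (-1) x := (hasDerivAt_id x).const_sub b
    have h2 := (((h1.const_mul γ).exp).const_mul Q).mul (h1.rpow_const (p := -α) (Or.inl hy.ne'))
    refine h2.congr_deriv ?_
    rw [Real.rpow_sub_one hy.ne']
    simp only [Φ, q]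
    field_simp
  have hq : ∀ x ∈ Ico 0 b, HasDerivAt q (α / (b - x) ^ 2) x := fun x hx => by
    have hy := sub_pos.2 hx.2
    have h1 : HasDerivAt (fun x => b - x) (-1) x := (hasDerivAt_id x).const_sub b
    refine (((hasDerivAt_const x α).div h1 hy.ne').const_add (-γ)).congr_deriv ?_
    simp
  have hlow : ∀ x ∈ Ico 0 b, Q * (b - x) ^ (-α) ≤ Φ x := fun x hx => by
    have hy := sub_pos.2 hx.2
    refine mul_le_mul_of_nonneg_right ?_ (Real.rpow_nonneg hy.le _)
    exact le_mul_of_one_le_right hQ.le (Real.one_le_exp (by positivity))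
  refine ⟨Φ, fun x => Φ x * q x, fun x => Φ x * (q x ^ 2 + α / (b - x) ^ 2),
    .of_forall hΦ fun x hx => ?_, hpos, fun x hx => ?_, ?_, ?_⟩
  · refine ((hΦ x hx).mul (hq x hx)).congr_deriv ?_
    ring
  · have hy := sub_pos.2 hx.2
    have hyb : (b - x) ^ 2 ≤ b ^ 2 := by nlinarith [hx.1]
    have h1 : Q ^ (p - 1) / (b - x) ^ 2 ≤ |Φ x| ^ (p - 1) := by
      rw [abs_of_pos (hpos x hx)]
      have h2 := Real.rpow_le_rpow (by positivity) (hlow x hx) hp'.le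
      rw [Real.mul_rpow hQ.le (Real.rpow_nonneg hy.le _), ← Real.rpow_mul hy.le,
        show -α * (p - 1) = -2 by rw [hα]; field_simp, Real.rpow_neg hy.le, Real.rpow_two] at h2
      exact h2
    have h3 : q x ^ 2 + α / (b - x) ^ 2 + l ≤ a₀ * (Q ^ (p - 1) / (b - x) ^ 2) := by
      rw [← mul_div_assoc, le_div_iff₀ (by positivity)]
      refine le_trans ?_ hKQ
      have h4 : (q x ^ 2 + α / (b - x) ^ 2 + l) * (b - x) ^ 2
          = (-γ * (b - x) + α) ^ 2 + α + l * (b - x) ^ 2 := by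
        simp only [q]
        field_simp
      rw [h4]
      have h5 : l * (b - x) ^ 2 ≤ |l| * b ^ 2 :=
        (mul_le_mul_of_nonneg_right (le_abs_self l) (sq_nonneg _)).trans
          (mul_le_mul_of_nonneg_left hyb (abs_nonneg l))
      have h6 : γ ^ 2 * (b - x) ^ 2 ≤ γ ^ 2 * b ^ 2 := mul_le_mul_of_nonneg_left hyb (sq_nonneg γ)
      nlinarith [sq_nonneg (γ * (b - x) + α)]
    have h7 := h3.trans (mul_le_mul_of_nonneg_left h1 ha₀.le)
    have h8 := mul_le_mul_of_nonneg_left h7 (hpos x hx).le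
    linarith
  · have h0 := hpos 0 ⟨le_rfl, hb⟩
    have h1 : q 0 ≤ β := by
      simp only [q, sub_zero, hγ]
      linarith [neg_abs_le β]
    show Φ 0 * q 0 ≤ β * Φ 0
    nlinarith
  · have h1 : Tendsto (fun x => b - x) (𝓝[<] b) (𝓝[>] 0) := by
      refine tendsto_nhdsWithin_iff.2 ⟨?_, ?_⟩
      · have : Tendsto (fun x => b - x) (𝓝 b) (𝓝 (b - b)) := tendsto_const_nhds.sub tendsto_id
        rw [sub_self] at this
        exact this.mono_left nhdsWithin_le_nhds
      · filter_upwards [self_mem_nhdsWithin] with x hx using sub_pos.2 (mem_Iio.1 hx)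
    have h2 := ((tendsto_rpow_neg_nhdsGT_zero (neg_neg_of_pos hα0)).comp h1).const_mul_atTop hQ
    refine tendsto_atTop_mono' _ ?_ h2
    filter_upwards [Ioo_mem_nhdsLT hb] with x hx using hlow x ⟨hx.1.le, hx.2⟩

/-! ### Minimal and maximal solutions -/

namespace IsSolOn

variable {p l b : ℝ} {a u u' v v' : ℝ → ℝ} {B : BoundaryOp}

/-- Two solutions on `[0,b]` are ordered like their values at `b`. -/
lemma le_of_le (hp : 1 < p) (ha_pos : ∀ x ∈ Icc 0 b, 0 < a x)
    (hv : IsSolOn (Icc 0 b) p a B l v v') (hu : IsSolOn (Icc 0 b) p a B l u u') (h : v b ≤ u b) :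
    ∀ x ∈ Icc 0 b, v x ≤ u x :=
  comparison_Icc hv.derivs hu.derivs (fun x hx => hu.pos x ⟨hx.1.le, hx.2⟩ hx.1)
    (fun x hx hlt => wronskian_deriv_nonneg hp (ha_pos x (Ioo_subset_Icc_self hx)).le
      (hu.pos x (Ioo_subset_Icc_self hx) hx.1) hlt.le le_rfl le_rfl)
    (B.wronskian_eq_zero hu.boundary hv.boundary).ge h

/-- A solution on `[0,b]` lies below every solution that blows up at `b`. -/
lemma le_of_tendsto (hp : 1 < p) (ha_pos : ∀ x ∈ Icc 0 b, 0 < a x)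
    (hv : IsSolOn (Icc 0 b) p a B l v v') (hu : IsSolOn (Ico 0 b) p a B l u u')
    (h : Tendsto u (𝓝[<] b) atTop) : ∀ x ∈ Ico 0 b, v x ≤ u x :=
  comparison_of_tendsto hv.derivs hu.derivs (fun x hx => hu.pos x ⟨hx.1.le, hx.2⟩ hx.1)
    (fun x hx hlt => wronskian_deriv_nonneg hp (ha_pos x (Ioo_subset_Icc_self hx)).le
      (hu.pos x (Ioo_subset_Ico_self hx) hx.1) hlt.le le_rfl le_rfl)
    (B.wronskian_eq_zero hu.boundary hv.boundary).ge h

end IsSolOn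

/-- Away from `b`, the solutions on `[0,b]` are bounded by a constant that depends neither on their
values at `b` nor on the parameter, as long as the latter is bounded from above. -/
lemma exists_upper_bound {p b c l : ℝ} {a : ℝ → ℝ} (B : BoundaryOp) (hp : 1 < p) (hb : 0 < b)
    (ha : ContinuousOn a (Icc 0 b)) (ha_pos : ∀ x ∈ Icc 0 b, 0 < a x) (hcb : c < b) :
    ∃ C, ∀ l' ≤ l, ∀ u u' : ℝ → ℝ, IsSolOn (Icc 0 b) p a B l' u u' → ∀ x ∈ Icc 0 c, u x ≤ C := by
  obtain ⟨x₀, hx₀, hmin⟩ := isCompact_Icc.exists_isMinOn ⟨b, hb.le, le_rfl⟩ ha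
  obtain ⟨Φ, Φ', Φ'', hΦ, hpos, hsuper, hΦ0, hblow⟩ := exists_barrier B hp hb (ha_pos x₀ hx₀) l
  have hsub : Icc 0 c ⊆ Ico 0 b := fun x hx => ⟨hx.1, hx.2.trans_lt hcb⟩
  obtain ⟨C, hC⟩ := (isCompact_Icc.image_of_continuousOn (hΦ.continuousOn.mono hsub)).bddAbove
  refine ⟨C, fun l' hl' u u' hu x hx => ?_⟩
  refine le_trans ?_ (hC (mem_image_of_mem Φ hx))
  refine comparison_of_tendsto hu.derivs hΦ (fun y hy => hpos y (Ioo_subset_Ico_self hy))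
    (fun y hy hlt => ?_) ?_ hblow x (hsub hx)
  · have hy' := Ioo_subset_Ico_self hy
    refine wronskian_deriv_nonneg hp (ha_pos y (Ioo_subset_Icc_self hy)).le (hpos y hy') hlt.le
      le_rfl ((hsuper y hy').trans ?_)
    have h1 : a x₀ ≤ a y := hmin (Ioo_subset_Icc_self hy)
    have h2 := hpos y hy'
    have h3 : 0 ≤ |Φ y| ^ (p - 1) * Φ y := by positivity
    nlinarith [mul_le_mul_of_nonneg_right h1 h3, mul_le_mul_of_nonneg_right hl' h2.le]
  · exact hu.wronskian_nonneg hb (hpos 0 ⟨le_rfl, hb⟩).le hΦ0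

/-- A positive pointwise limit of solutions that are locally bounded in `[0,R)` is a solution. -/
lemma exists_isSolOn_of_tendsto {p R l : ℝ} {a U : ℝ → ℝ} {B : BoundaryOp} {u u' : ℕ → ℝ → ℝ}
    (hp : 1 < p) (hR : 0 < R) (ha : ContinuousOn a (Icc 0 R)) (ha_pos : ∀ x ∈ Icc 0 R, 0 < a x)
    (hu : ∀ c ∈ Ioo 0 R, ∀ᶠ n in atTop, IsSolOn (Icc 0 c) p a B l (u n) (u' n))
    (hbd : ∀ c ∈ Ioo 0 R, ∃ C, ∀ᶠ n in atTop, ∀ x ∈ Icc 0 c, u n x ≤ C)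
    (hlim : ∀ x ∈ Ico 0 R, Tendsto (fun n => u n x) atTop (𝓝 (U x)))
    (hpos : ∀ x ∈ Ioo 0 R, 0 < U x) :
    ∃ U', IsSolOn (Ico 0 R) p a B l U U' := by
  obtain ⟨x₁, hx₁, hmax⟩ := isCompact_Icc.exists_isMaxOn ⟨R, hR.le, le_rfl⟩ ha
  let G : ℝ → ℝ := fun x => a x * (|U x| ^ (p - 1) * U x) - l * U x
  have key : ∀ c ∈ Ioo 0 R, ∃ d, Tendsto (fun n => u' n 0) atTop (𝓝 d) ∧
      HasTwoDerivsOn (Icc 0 c) U (fun x => d + ∫ t in (0 : ℝ)..x, G t) G := by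
    intro c hc
    have hsub : Icc 0 c ⊆ Icc 0 R := Icc_subset_Icc_right hc.2.le
    have hsub' : Icc 0 c ⊆ Ico 0 R := fun x hx => ⟨hx.1, hx.2.trans_lt hc.2⟩
    obtain ⟨C, hC⟩ := hbd c hc
    obtain ⟨d, hd, hUc, hUd⟩ := exists_limit_of_tendsto (b := c)
      (C := a x₁ * (|C| ^ (p - 1) * |C|) + |l| * |C|) (G := G) hc.1
      ((hu c hc).mono fun n hn => hn.derivs)
      ((hu c hc).mono fun n hn => continuousOn_rhs hp (ha.mono hsub) hn.derivs.continuousOn)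
      (by
        filter_upwards [hu c hc, hC] with n hn hCn x hx
        have h0 := hn.nonneg hc.1 hx
        have h1 : |u n x| ≤ |C| := by
          rw [abs_of_nonneg h0]
          exact (hCn x hx).trans (le_abs_self C)
        have h2 : |a x * (|u n x| ^ (p - 1) * u n x)| ≤ a x₁ * (|C| ^ (p - 1) * |C|) := by
          rw [abs_mul, abs_mul, abs_of_pos (ha_pos x (hsub hx)),
            abs_of_nonneg (Real.rpow_nonneg (abs_nonneg (u n x)) _)]
          refine mul_le_mul (hmax (hsub hx)) ?_ (by positivity) (ha_pos x₁ hx₁).le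
          exact mul_le_mul (Real.rpow_le_rpow (abs_nonneg _) h1 (by linarith)) h1 (abs_nonneg _)
            (by positivity)
        have h3 : |l * u n x| ≤ |l| * |C| := by
          rw [abs_mul]
          exact mul_le_mul_of_nonneg_left h1 (abs_nonneg l)
        exact (abs_sub _ _).trans (add_le_add h2 h3))
      (fun x hx => hlim x (hsub' hx))
      (fun x hx => ((((continuous_abs_rpow_mul hp).tendsto _).comp (hlim x (hsub' hx))).const_mul
        _).sub ((hlim x (hsub' hx)).const_mul _))
    exact ⟨d, hd, hUd (continuousOn_rhs hp (ha.mono hsub) hUc)⟩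
  have hhalf : R / 2 ∈ Ioo 0 R := ⟨by linarith, by linarith⟩
  obtain ⟨d, hd, -⟩ := key _ hhalf
  refine ⟨fun x => d + ∫ t in (0 : ℝ)..x, G t, fun x hx => ?_, fun x hx h0 => hpos x ⟨h0, hx.2⟩, ?_⟩
  · obtain ⟨c, hxc, hcR⟩ := exists_between hx.2
    obtain ⟨d', hd', hder⟩ := key c ⟨hx.1.trans_lt hxc, hcR⟩
    obtain rfl := tendsto_nhds_unique hd hd'
    have hmem : Icc 0 c ∈ 𝓝[Ico 0 R] x := by
      filter_upwards [self_mem_nhdsWithin, mem_nhdsWithin_of_mem_nhds (Iio_mem_nhds hxc)]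
        with y hy1 hy2 using ⟨hy1.1, (mem_Iio.1 hy2).le⟩
    exact ⟨(hder x ⟨hx.1, hxc.le⟩).1.mono_of_mem_nhdsWithin hmem,
      (hder x ⟨hx.1, hxc.le⟩).2.mono_of_mem_nhdsWithin hmem⟩
  · simp only [intervalIntegral.integral_same, add_zero]
    refine tendsto_nhds_unique (B.tendsto_apply (hlim 0 ⟨le_rfl, hR⟩) hd) ?_
    exact tendsto_const_nhds.congr' ((hu _ hhalf).mono fun n hn => hn.boundary.symm)

/-- The minimal solution that blows up at `R` is the increasing limit of the solutions with the
values `1, 2, 3, …` at `R`. -/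
theorem exists_minimal {p R : ℝ} {a : ℝ → ℝ} (B : BoundaryOp) (hp : 1 < p) (hR : 0 < R)
    (ha : ContinuousOn a (Icc 0 R)) (ha_pos : ∀ x ∈ Icc 0 R, 0 < a x) (l : ℝ) :
    ∃ u u' : ℝ → ℝ, IsSolOn (Ico 0 R) p a B l u u' ∧ Tendsto u (𝓝[<] R) atTop ∧
      ∀ v v' : ℝ → ℝ, IsSolOn (Ico 0 R) p a B l v v' → Tendsto v (𝓝[<] R) atTop →
        ∀ x ∈ Ico 0 R, u x ≤ v x := by
  choose u u' hu huR using fun n : ℕ =>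
    exists_finite_solution (l := l) B hp hR ha ha_pos (Nat.cast_add_one_pos n : (0 : ℝ) < n + 1)
  have hmono : ∀ x ∈ Icc 0 R, Monotone fun n => u n x := fun x hx =>
    monotone_nat_of_le_succ fun n => (hu n).le_of_le hp ha_pos (hu (n + 1)) (by
      rw [huR, huR]
      push_cast
      linarith) x hx
  have hC : ∀ c ∈ Ioo 0 R, ∃ C, ∀ n, ∀ x ∈ Icc 0 c, u n x ≤ C := fun c hc => by
    obtain ⟨C, hC⟩ := exists_upper_bound (l := l) B hp hR ha ha_pos hc.2
    exact ⟨C, fun n x hx => hC l le_rfl _ _ (hu n) x hx⟩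
  have hbdd : ∀ x ∈ Ico 0 R, BddAbove (range fun n => u n x) := fun x hx => by
    obtain ⟨c, hxc, hcR⟩ := exists_between hx.2
    obtain ⟨C, hC⟩ := hC c ⟨hx.1.trans_lt hxc, hcR⟩
    exact ⟨C, by rintro _ ⟨n, rfl⟩; exact hC n x ⟨hx.1, hxc.le⟩⟩
  have hle : ∀ n, ∀ x ∈ Ico 0 R, u n x ≤ ⨆ n, u n x := fun n x hx => le_ciSup (hbdd x hx) n
  obtain ⟨U', hU'⟩ := exists_isSolOn_of_tendsto (U := fun x => ⨆ n, u n x) hp hR ha ha_pos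
    (fun c hc => Eventually.of_forall fun n => (hu n).mono (Icc_subset_Icc_right hc.2.le))
    (fun c hc => (hC c hc).imp fun C hC => Eventually.of_forall hC)
    (fun x hx => tendsto_atTop_ciSup (hmono x (Ico_subset_Icc_self hx)) (hbdd x hx))
    (fun x hx => ((hu 0).pos x (Ioo_subset_Icc_self hx) hx.1).trans_le
      (hle 0 x (Ioo_subset_Ico_self hx)))
  refine ⟨_, U', hU', ?_, fun v v' hv hvR x hx => ciSup_le fun n =>
    (hu n).le_of_tendsto hp ha_pos hv hvR x hx⟩
  rw [tendsto_atTop]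
  intro M
  obtain ⟨n, hn⟩ := exists_nat_gt M
  have hRm : R ∈ Icc 0 R := ⟨hR.le, le_rfl⟩
  have hle' : 𝓝[<] R ≤ 𝓝[Icc 0 R] R :=
    nhdsWithin_le_iff.2 (mem_of_superset (Ioo_mem_nhdsLT hR) Ioo_subset_Icc_self)
  have ht := ((hu n).derivs.continuousOn R hRm).mono_left hle'
  filter_upwards [ht.eventually (eventually_gt_nhds (by rw [huR]; linarith : M < u n R)),
    Ioo_mem_nhdsLT hR] with x hx1 hx2
  exact hx1.le.trans (hle n x (Ioo_subset_Ico_self hx2))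

/-- The maximal solution that blows up at `R` is the decreasing limit of the minimal solutions that
blow up at `b n`, for a sequence `b n ↑ R`. -/
theorem exists_maximal {p R : ℝ} {a : ℝ → ℝ} (B : BoundaryOp) (hp : 1 < p) (hR : 0 < R)
    (ha : ContinuousOn a (Icc 0 R)) (ha_pos : ∀ x ∈ Icc 0 R, 0 < a x) (l : ℝ) :
    ∃ u u' : ℝ → ℝ, IsSolOn (Ico 0 R) p a B l u u' ∧ Tendsto u (𝓝[<] R) atTop ∧
      ∀ v v' : ℝ → ℝ, IsSolOn (Ico 0 R) p a B l v v' → ∀ x ∈ Ico 0 R, v x ≤ u x := by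
  obtain ⟨b, hbmono, hbmem, hbR⟩ := exists_seq_strictMono_tendsto' hR
  have hb : ∀ n, 0 < b n := fun n => (hbmem n).1
  have hsub : ∀ n, Icc 0 (b n) ⊆ Icc 0 R := fun n => Icc_subset_Icc_right (hbmem n).2.le
  choose u u' hu hblow _ using fun n =>
    exists_minimal B hp (hb n) (ha.mono (hsub n)) (fun x hx => ha_pos x (hsub n hx)) l
  -- solutions beyond `b n` lie below `u n`
  have hle : ∀ n v v', IsSolOn (Icc 0 (b n)) p a B l v v' → ∀ x ∈ Ico 0 (b n), v x ≤ u n x :=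
    fun n v v' hv => hv.le_of_tendsto hp (fun x hx => ha_pos x (hsub n hx)) (hu n) (hblow n)
  have hle_seq : ∀ n m, n < m → ∀ x ∈ Ico 0 (b n), u m x ≤ u n x := fun n m hnm =>
    hle n _ _ ((hu m).mono fun x hx => ⟨hx.1, hx.2.trans_lt (hbmono hnm)⟩)
  have hle_sol : ∀ n v v', IsSolOn (Ico 0 R) p a B l v v' → ∀ x ∈ Ico 0 (b n), v x ≤ u n x :=
    fun n v v' hv => hle n v v' (hv.mono fun x hx => ⟨hx.1, hx.2.trans_lt (hbmem n).2⟩)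
  have hex : ∀ x ∈ Ico 0 R, ∃ L, Tendsto (fun n => u n x) atTop (𝓝 L) := by
    intro x hx
    obtain ⟨N, hN⟩ := (hbR.eventually (eventually_gt_nhds hx.2)).exists
    have hxN : ∀ n, x ∈ Ico 0 (b (n + N)) := fun n =>
      ⟨hx.1, hN.trans_le (hbmono.monotone (Nat.le_add_left N n))⟩
    have hanti : Antitone fun n => u (n + N) x := antitone_nat_of_succ_le fun n =>
      hle_seq _ _ (by omega) x (hxN n)
    have hbdd : BddBelow (range fun n => u (n + N) x) := by
      refine ⟨0, ?_⟩
      rintro _ ⟨n, rfl⟩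
      have hsub' : Icc 0 ((x + b (n + N)) / 2) ⊆ Ico 0 (b (n + N)) := fun y hy =>
        ⟨hy.1, by linarith [hy.2, (hxN n).2]⟩
      exact ((hu (n + N)).mono hsub').nonneg (by linarith [hx.1, hb (n + N)])
        ⟨hx.1, by linarith [(hxN n).2]⟩
    exact ⟨_, (tendsto_add_atTop_iff_nat N).1 (tendsto_atTop_ciInf hanti hbdd)⟩
  choose! U hU using hex
  have hleU : ∀ v v', IsSolOn (Ico 0 R) p a B l v v' → ∀ x ∈ Ico 0 R, v x ≤ U x := by
    intro v v' hv x hx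
    refine ge_of_tendsto (hU x hx) ?_
    filter_upwards [hbR.eventually (eventually_gt_nhds hx.2)] with n hn
    exact hle_sol n v v' hv x ⟨hx.1, hn⟩
  obtain ⟨w, w', hw, hwR, -⟩ := exists_minimal B hp hR ha ha_pos l
  obtain ⟨U', hU'⟩ := exists_isSolOn_of_tendsto (u := u) (u' := u') hp hR ha ha_pos
    (fun c hc => (hbR.eventually (eventually_gt_nhds hc.2)).mono fun n hn =>
      (hu n).mono fun x hx => ⟨hx.1, hx.2.trans_lt hn⟩)
    (fun c hc => by
      obtain ⟨N, hN⟩ := (hbR.eventually (eventually_gt_nhds hc.2)).exists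
      have hsub' : Icc 0 c ⊆ Ico 0 (b N) := fun x hx => ⟨hx.1, hx.2.trans_lt hN⟩
      obtain ⟨C, hC⟩ := (isCompact_Icc.image_of_continuousOn
        ((hu N).derivs.continuousOn.mono hsub')).bddAbove
      refine ⟨C, (eventually_gt_atTop N).mono fun n hn x hx => ?_⟩
      exact (hle_seq N n hn x (hsub' hx)).trans (hC (mem_image_of_mem _ hx)))
    hU (fun x hx => (hw.pos x (Ioo_subset_Ico_self hx) hx.1).trans_le
      (hleU w w' hw x (Ioo_subset_Ico_self hx)))
  refine ⟨U, U', hU', tendsto_atTop_mono' _ ?_ hwR, hleU⟩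
  filter_upwards [Ioo_mem_nhdsLT hR] with x hx using hleU w w' hw x (Ioo_subset_Ico_self hx)

/-! ### Dependence on the parameter and uniqueness -/

lemma IsCompact.exists_subset_Icc {K : Set ℝ} {R : ℝ} (hR : 0 < R) (hK : IsCompact K)
    (hKR : K ⊆ Ico 0 R) : ∃ k ∈ Ioo 0 R, K ⊆ Icc 0 k := by
  rcases K.eq_empty_or_nonempty with rfl | hne
  · exact ⟨R / 2, ⟨by linarith, by linarith⟩, empty_subset _⟩
  · obtain ⟨m, hm, hmax⟩ := hK.exists_isGreatest hne
    have h1 := hKR hm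
    exact ⟨(m + R) / 2, ⟨by linarith [h1.1], by linarith [h1.2]⟩, fun x hx =>
      ⟨(hKR hx).1, by linarith [hmax hx, h1.2]⟩⟩

/-- If `-w'' ≤ C w` in `[0,d]` and `w(d) = 0`, every multiple of `w` is a subsolution for large
values of the parameter, hence a lower bound of all positive solutions. -/
lemma eventually_mul_le {p R d C m : ℝ} {a w w' w'' : ℝ → ℝ} {B : BoundaryOp} (hp : 1 < p)
    (ha : ContinuousOn a (Icc 0 R)) (ha_pos : ∀ x ∈ Icc 0 R, 0 < a x) (hd : d ∈ Ioo 0 R)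
    (hw : HasTwoDerivsOn (Icc 0 d) w w' w'') (hw0 : ∀ x ∈ Icc 0 d, 0 ≤ w x) (hwd : w d = 0)
    (hwC : ∀ x ∈ Icc 0 d, -(C * w x) ≤ w'' x)
    (hB : ∀ u₀ u₁ : ℝ, B.apply u₀ u₁ = 0 → 0 ≤ u₀ → 0 ≤ w' 0 * u₀ - w 0 * u₁) (hm : 0 ≤ m) :
    ∀ᶠ l in atTop, ∀ u u' : ℝ → ℝ, IsSolOn (Ico 0 R) p a B l u u' →
      ∀ x ∈ Icc 0 d, m * w x ≤ u x := by
  have hdm : d ∈ Icc 0 d := ⟨hd.1.le, le_rfl⟩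
  have hsub : Icc 0 d ⊆ Icc 0 R := Icc_subset_Icc_right hd.2.le
  have hsub' : Icc 0 d ⊆ Ico 0 R := fun x hx => ⟨hx.1, hx.2.trans_lt hd.2⟩
  obtain ⟨x₁, hx₁, hmax⟩ := isCompact_Icc.exists_isMaxOn ⟨d, hdm⟩ (ha.mono hsub)
  obtain ⟨x₂, hx₂, hwmax⟩ := isCompact_Icc.exists_isMaxOn ⟨d, hdm⟩ hw.continuousOn
  filter_upwards [eventually_ge_atTop (C + a x₁ * (m * w x₂) ^ (p - 1))] with l hl u u' hu
  have hu := hu.mono hsub'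
  refine comparison_Icc (v := fun x => m * w x) (v' := fun x => m * w' x) (v'' := fun x => m * w'' x)
    (fun x hx => ⟨(hw x hx).1.const_mul m, (hw x hx).2.const_mul m⟩) hu.derivs
    (fun x hx => hu.pos x ⟨hx.1.le, hx.2⟩ hx.1) (fun x hx hlt => ?_) ?_ ?_
  · have hx' := Ioo_subset_Icc_self hx
    refine wronskian_deriv_nonneg hp (ha_pos x (hsub hx')).le (hu.pos x hx' hx.1) hlt.le ?_ le_rfl
    have hmw : 0 ≤ m * w x := mul_nonneg hm (hw0 x hx')
    have h1 : a x * |m * w x| ^ (p - 1) ≤ a x₁ * (m * w x₂) ^ (p - 1) := by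
      rw [abs_of_nonneg hmw]
      refine mul_le_mul (hmax hx') ?_ (by positivity) (ha_pos x₁ (hsub hx₁)).le
      exact Real.rpow_le_rpow hmw (mul_le_mul_of_nonneg_left (hwmax hx') hm) (by linarith)
    have h2 : (a x * |m * w x| ^ (p - 1)) * (m * w x) ≤ (l - C) * (m * w x) :=
      mul_le_mul_of_nonneg_right (by linarith) hmw
    have h3 := mul_le_mul_of_nonneg_left (hwC x hx') hm
    linarith
  · have h1 := mul_nonneg hm (hB (u 0) (u' 0) hu.boundary (hu.nonneg_zero hd.1))
    linarith
  · show m * w d ≤ u d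
    rw [hwd, mul_zero]
    exact hu.nonneg hd.1 hdm

/-- For a Neumann or Robin condition, all positive solutions become large on compact subsets of
`[0,R)` as the parameter tends to `+∞`. -/
theorem eventually_gt_of_ne_dirichlet {p R : ℝ} {a : ℝ → ℝ} {B : BoundaryOp} (hp : 1 < p)
    (hR : 0 < R) (ha : ContinuousOn a (Icc 0 R)) (ha_pos : ∀ x ∈ Icc 0 R, 0 < a x)
    (hB : B ≠ .dirichlet) {K : Set ℝ} (hKR : K ⊆ Ico 0 R) (hK : IsCompact K) (M : ℝ) :
    ∀ᶠ l in atTop, ∀ u u' : ℝ → ℝ, IsSolOn (Ico 0 R) p a B l u u' → ∀ x ∈ K, M < u x := by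
  obtain ⟨k, hk, hKk⟩ := hK.exists_subset_Icc hR hKR
  obtain ⟨d, hkd, hdR⟩ := exists_between hk.2
  have hd : 0 < d := hk.1.trans hkd
  set β := B.slope with hβ
  -- the subsolution is a multiple of `(d - x)² exp(γ x)`, which satisfies `w'' ≥ -γ² w`;
  -- the choice of `γ` makes `w'(0) = |β| w(0)`
  set γ := |β| + 2 / d with hγ
  have hγ0 : 0 < γ := by positivity
  have hexp : ∀ x, HasDerivAt (fun x => Real.exp (γ * x)) (γ * Real.exp (γ * x)) x := fun x => by
    simpa [mul_comm] using ((hasDerivAt_id x).const_mul γ).exp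
  have hsub : ∀ x, HasDerivAt (fun x => d - x) (-1) x := fun x => (hasDerivAt_id x).const_sub d
  have hw : HasTwoDerivsOn (Icc 0 d) (fun x => (d - x) ^ 2 * Real.exp (γ * x))
      (fun x => (γ * (d - x) ^ 2 - 2 * (d - x)) * Real.exp (γ * x))
      (fun x => (γ ^ 2 * (d - x) ^ 2 - 4 * γ * (d - x) + 2) * Real.exp (γ * x)) := by
    refine .of_forall (fun x _ => ?_) (fun x _ => ?_)
    · refine (((hsub x).pow 2).mul (hexp x)).congr_deriv ?_
      simp
      ring
    · refine (((((hsub x).pow 2).const_mul γ).sub ((hsub x).const_mul 2)).mul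
        (hexp x)).congr_deriv ?_
      simp
      ring
  have hdk : 0 < (d - k) ^ 2 := pow_pos (sub_pos.2 hkd) 2
  have hev := eventually_mul_le (C := γ ^ 2) (m := (|M| + 1) / (d - k) ^ 2) (B := B) hp ha ha_pos
    ⟨hd, hdR⟩ hw (fun x _ => by positivity) (by simp) (fun x _ => ?_) (fun u₀ u₁ hu hu₀ => ?_)
    (by positivity)
  · filter_upwards [hev] with l hl u u' hu x hx
    have hxk := hKk hx
    refine lt_of_lt_of_le ?_ (hl u u' hu x ⟨hxk.1, hxk.2.trans hkd.le⟩)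
    have h1 : (d - k) ^ 2 ≤ (d - x) ^ 2 * Real.exp (γ * x) := by
      have h2 : 1 ≤ Real.exp (γ * x) := Real.one_le_exp (mul_nonneg hγ0.le hxk.1)
      have h3 : (d - k) ^ 2 ≤ (d - x) ^ 2 :=
        pow_le_pow_left₀ (sub_pos.2 hkd).le (by linarith [hxk.2]) 2
      exact h3.trans (le_mul_of_one_le_right (sq_nonneg _) h2)
    calc M < |M| + 1 := by linarith [le_abs_self M]
      _ = (|M| + 1) / (d - k) ^ 2 * (d - k) ^ 2 := by field_simp
      _ ≤ _ := mul_le_mul_of_nonneg_left h1 (by positivity)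
  · have h1 := Real.exp_pos (γ * x)
    have h2 : 0 ≤ 2 * (γ * (d - x) - 1) ^ 2 * Real.exp (γ * x) := by positivity
    linarith
  · rw [BoundaryOp.apply_eq_zero_iff hB] at hu
    have h1 : (γ * d ^ 2 - 2 * d) - d ^ 2 * β = (|β| - β) * d ^ 2 := by
      rw [hγ]
      field_simp
      ring
    have h2 : 0 ≤ (|β| - β) * d ^ 2 * u₀ :=
      mul_nonneg (mul_nonneg (sub_nonneg.2 (le_abs_self β)) (sq_nonneg d)) hu₀
    rw [hu]
    simp only [sub_zero, mul_zero, Real.exp_zero, mul_one]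
    rw [← h1] at h2
    linarith

/-- For the Dirichlet condition, all positive solutions become large on compact subsets of `(0,R)`
as the parameter tends to `+∞`. -/
theorem eventually_gt_of_dirichlet {p R : ℝ} {a : ℝ → ℝ} (hp : 1 < p)
    (hR : 0 < R) (ha : ContinuousOn a (Icc 0 R)) (ha_pos : ∀ x ∈ Icc 0 R, 0 < a x)
    {K : Set ℝ} (hKR : K ⊆ Ioo 0 R) (hK : IsCompact K) (M : ℝ) :
    ∀ᶠ l in atTop, ∀ u u' : ℝ → ℝ, IsSolOn (Ico 0 R) p a .dirichlet l u u' →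
      ∀ x ∈ K, M < u x := by
  rcases K.eq_empty_or_nonempty with rfl | hne
  · simp
  obtain ⟨k, hk, hKk⟩ := hK.exists_subset_Icc hR (hKR.trans Ioo_subset_Ico_self)
  obtain ⟨d, hkd, hdR⟩ := exists_between hk.2
  have hd : 0 < d := hk.1.trans hkd
  set ω := Real.pi / d with hω
  have hω0 : 0 < ω := div_pos Real.pi_pos hd
  have hωd : ω * d = Real.pi := div_mul_cancel₀ _ hd.ne'
  have hs : ∀ x, HasDerivAt (fun x => Real.sin (ω * x)) (ω * Real.cos (ω * x)) x := fun x => by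
    simpa [mul_comm] using ((hasDerivAt_id x).const_mul ω).sin
  have hc : ∀ x, HasDerivAt (fun x => Real.cos (ω * x)) (-(ω * Real.sin (ω * x))) x := fun x => by
    simpa [mul_comm] using ((hasDerivAt_id x).const_mul ω).cos
  have hw : HasTwoDerivsOn (Icc 0 d) (fun x => Real.sin (ω * x)) (fun x => ω * Real.cos (ω * x))
      (fun x => -(ω ^ 2 * Real.sin (ω * x))) :=
    .of_forall (fun x _ => hs x) (fun x _ => ((hc x).const_mul ω).congr_deriv (by ring))
  have hKd : K ⊆ Icc 0 d := fun x hx => ⟨(hKk hx).1, (hKk hx).2.trans hkd.le⟩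
  have harg : ∀ x ∈ Icc 0 d, ω * x ≤ Real.pi := fun x hx =>
    (mul_le_mul_of_nonneg_left hx.2 hω0.le).trans hωd.le
  obtain ⟨x₀, hx₀, hmin⟩ := hK.exists_isMinOn hne (hw.continuousOn.mono hKd)
  have hx₀pos : 0 < Real.sin (ω * x₀) := by
    refine Real.sin_pos_of_pos_of_lt_pi (mul_pos hω0 (hKR hx₀).1) ?_
    rw [← hωd]
    exact mul_lt_mul_of_pos_left ((hKk hx₀).2.trans_lt hkd) hω0
  have hev := eventually_mul_le (C := ω ^ 2) (m := (|M| + 1) / Real.sin (ω * x₀))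
    (B := .dirichlet) hp ha ha_pos ⟨hd, hdR⟩ hw
    (fun x hx => Real.sin_nonneg_of_nonneg_of_le_pi (mul_nonneg hω0.le hx.1) (harg x hx))
    (by rw [hωd, Real.sin_pi]) (fun x _ => le_rfl) (fun u₀ u₁ hu _ => ?_) (by positivity)
  · filter_upwards [hev] with l hl u u' hu x hx
    refine lt_of_lt_of_le ?_ (hl u u' hu x (hKd hx))
    calc M < |M| + 1 := by linarith [le_abs_self M]
      _ = (|M| + 1) / Real.sin (ω * x₀) * Real.sin (ω * x₀) := by field_simp
      _ ≤ _ := mul_le_mul_of_nonneg_left (hmin hx) (by positivity)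
  · have hu : u₀ = 0 := hu
    simp [hu]

/-- All positive solutions become small on compact subsets of `[0,R)` as the parameter tends to
`-∞`: they are bounded on a larger interval `[0,c]`, and there they lie below a solution of
`E'' = κ² E`, `κ² = -l`, which decays like `exp(-κ (c - x))`. -/
theorem eventually_lt_atBot {p R : ℝ} {a : ℝ → ℝ} (B : BoundaryOp) (hp : 1 < p)
    (hR : 0 < R) (ha : ContinuousOn a (Icc 0 R)) (ha_pos : ∀ x ∈ Icc 0 R, 0 < a x)
    {K : Set ℝ} (hKR : K ⊆ Ico 0 R) (hK : IsCompact K) {ε : ℝ} (hε : 0 < ε) :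
    ∀ᶠ l in atBot, ∀ u u' : ℝ → ℝ, IsSolOn (Ico 0 R) p a B l u u' → ∀ x ∈ K, u x < ε := by
  obtain ⟨k, hk, hKk⟩ := hK.exists_subset_Icc hR hKR
  obtain ⟨c, hkc, hcR⟩ := exists_between hk.2
  obtain ⟨b, hcb, hbR⟩ := exists_between hcR
  have hc : 0 < c := hk.1.trans hkc
  have hb : 0 < b := hc.trans hcb
  have hbsub : Icc 0 b ⊆ Icc 0 R := Icc_subset_Icc_right hbR.le
  obtain ⟨C₀, hC₀⟩ := exists_upper_bound (l := 0) B hp hb (ha.mono hbsub)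
    (fun x hx => ha_pos x (hbsub hx)) hcb
  set C := |C₀| + 1 with hC
  have hCpos : 0 < C := by positivity
  have key : ∀ᶠ κ : ℝ in atTop, ∀ u u' : ℝ → ℝ, IsSolOn (Ico 0 R) p a B (-κ ^ 2) u u' →
      ∀ x ∈ K, u x < ε := by
    have hlim : Tendsto (fun κ : ℝ => 3 * C * Real.exp (-(κ * (c - k)))) atTop (𝓝 (3 * C * 0)) :=
      ((Real.tendsto_exp_neg_atTop_nhds_zero.comp
        (tendsto_id.atTop_mul_const (sub_pos.2 hkc)))).const_mul _
    rw [mul_zero] at hlim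
    filter_upwards [hlim.eventually (eventually_lt_nhds hε), eventually_ge_atTop (3 * |B.slope|)]
      with κ hκε hκβ u u' hu x hx
    have hκ0 : 0 ≤ κ := le_trans (by positivity) hκβ
    have hexp : ∀ κ x : ℝ, HasDerivAt (fun x => Real.exp (κ * x)) (κ * Real.exp (κ * x)) x :=
      fun κ x => by simpa [mul_comm] using ((hasDerivAt_id x).const_mul κ).exp
    -- `E(c) ≥ C`, and the weight `2` of the decreasing exponential gives `E'(0) = -(κ/3) E(0)`
    set A := C * Real.exp (-(κ * c)) with hA
    have hA0 : 0 < A := by positivity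
    have hE : HasTwoDerivsOn (Icc 0 c)
        (fun x => A * (Real.exp (κ * x) + 2 * Real.exp (-κ * x)))
        (fun x => A * (κ * Real.exp (κ * x) + 2 * (-κ * Real.exp (-κ * x))))
        (fun x => κ ^ 2 * (A * (Real.exp (κ * x) + 2 * Real.exp (-κ * x)))) := by
      refine .of_forall (fun x _ => ?_) (fun x _ => ?_)
      · exact ((hexp κ x).add ((hexp (-κ) x).const_mul 2)).const_mul A
      · refine ((((hexp κ x).const_mul κ).add
          (((hexp (-κ) x).const_mul (-κ)).const_mul 2)).const_mul A).congr_deriv ?_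
        ring
    have hsubc : Icc 0 c ⊆ Ico 0 R := fun y hy => ⟨hy.1, hy.2.trans_lt hcR⟩
    have huc := hu.mono hsubc
    have hxk := hKk hx
    have hle := comparison_Icc huc.derivs hE (fun y _ => by positivity) (fun y hy hlt => ?_) ?_ ?_
      x ⟨hxk.1, hxk.2.trans hkc.le⟩
    · refine hle.trans_lt (lt_of_le_of_lt ?_ hκε)
      have h1 : Real.exp (-(κ * c)) * Real.exp (κ * x) ≤ Real.exp (-(κ * (c - k))) := by
        rw [← Real.exp_add]
        exact Real.exp_le_exp.2 (by nlinarith [hxk.2])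
      have h2 : Real.exp (-(κ * c)) * Real.exp (-κ * x) ≤ Real.exp (-(κ * (c - k))) := by
        rw [← Real.exp_add]
        have h3 := mul_nonneg hκ0 hxk.1
        have h4 := mul_nonneg hκ0 hk.1.le
        exact Real.exp_le_exp.2 (by linarith)
      calc A * (Real.exp (κ * x) + 2 * Real.exp (-κ * x))
          = C * (Real.exp (-(κ * c)) * Real.exp (κ * x)
            + 2 * (Real.exp (-(κ * c)) * Real.exp (-κ * x))) := by rw [hA]; ring
        _ ≤ C * (Real.exp (-(κ * (c - k))) + 2 * Real.exp (-(κ * (c - k)))) :=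
          mul_le_mul_of_nonneg_left (by linarith) hCpos.le
        _ = _ := by ring
    · have hyR : y ∈ Icc 0 R := ⟨hy.1.le, (hy.2.trans hcR).le⟩
      have hay := ha_pos y hyR
      refine wronskian_deriv_nonneg hp hay.le (by positivity) hlt.le le_rfl ?_
      have : 0 ≤ a y * (|A * (Real.exp (κ * y) + 2 * Real.exp (-κ * y))| ^ (p - 1) *
        (A * (Real.exp (κ * y) + 2 * Real.exp (-κ * y)))) := by positivity
      linarith
    · refine huc.wronskian_nonneg hc (by positivity) ?_
      simp only [mul_zero, Real.exp_zero]
      nlinarith [neg_abs_le B.slope]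
    · have h1 := hC₀ (-κ ^ 2) (by nlinarith) u u'
        (hu.mono fun y hy => ⟨hy.1, hy.2.trans_lt hbR⟩) c ⟨hc.le, le_rfl⟩
      have h2 : C = A * Real.exp (κ * c) := by
        rw [hA, mul_assoc, ← Real.exp_add]
        simp
      have h3 : 0 ≤ A * (2 * Real.exp (-κ * c)) := by positivity
      linarith [le_abs_self C₀]
  have hsqrt : Tendsto (fun l : ℝ => √(-l)) atBot atTop :=
    Real.tendsto_sqrt_atTop.comp tendsto_neg_atBot_atTop
  filter_upwards [hsqrt.eventually key, eventually_le_atBot 0] with l hl hl0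
  rwa [Real.sq_sqrt (by linarith), neg_neg] at hl

/-- Uniqueness for nonincreasing weights. If `u ≤ v` are two solutions, `u` blows up at `R` and
`u ≠ v`, then `v / u` is strictly increasing somewhere. For small `δ > 0` the translate
`x ↦ v (x - δ)`, which is a subsolution since `a` is nonincreasing, is therefore larger than `u` at
some point, with a larger logarithmic derivative. By the comparison principle it cannot stay finite
up to `R`. -/
theorem le_of_antitoneOn {p R l : ℝ} {a u u' v v' : ℝ → ℝ} {B : BoundaryOp} (hp : 1 < p)
    (ha_pos : ∀ x ∈ Icc 0 R, 0 < a x) (hanti : AntitoneOn a (Icc 0 R))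
    (hu : IsSolOn (Ico 0 R) p a B l u u') (hv : IsSolOn (Ico 0 R) p a B l v v')
    (hblow : Tendsto u (𝓝[<] R) atTop) (huv : ∀ x ∈ Ico 0 R, u x ≤ v x) :
    ∀ x ∈ Ico 0 R, v x ≤ u x := by
  by_contra! hcon
  obtain ⟨y, hy, hlt⟩ := hcon
  obtain ⟨x₀, hx₀, hlt₀⟩ : ∃ x₀ ∈ Ioo 0 R, u x₀ < v x₀ := by
    have hle : 𝓝[>] y ≤ 𝓝[Ico 0 R] y := nhdsWithin_le_iff.2
      (mem_of_superset (Ioo_mem_nhdsGT hy.2) fun z hz => ⟨hy.1.trans hz.1.le, hz.2⟩)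
    have h1 := ((hu.derivs.continuousOn y hy).mono_left hle).eventually_lt
      ((hv.derivs.continuousOn y hy).mono_left hle) hlt
    obtain ⟨z, hz1, hz2⟩ := (h1.and (Ioo_mem_nhdsGT hy.2)).exists
    exact ⟨z, ⟨hy.1.trans_lt hz2.1, hz2.2⟩, hz1⟩
  have hnhds : ∀ x ∈ Ioo 0 R, Ico 0 R ∈ 𝓝 x := fun x hx => Ico_mem_nhds hx.1 hx.2
  have hud := fun x hx => hu.derivs.hasDerivAt (hnhds x hx)
  have hud' := fun x hx => hu.derivs.hasDerivAt' (hnhds x hx)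
  have hvd := fun x hx => hv.derivs.hasDerivAt (hnhds x hx)
  have hvd' := fun x hx => hv.derivs.hasDerivAt' (hnhds x hx)
  obtain ⟨x₁, hx₁, hlt₁, hZ₁⟩ : ∃ x₁ ∈ Ioo 0 R, u x₁ < v x₁ ∧ 0 < v' x₁ * u x₁ - v x₁ * u' x₁ := by
    have hsub : Icc 0 x₀ ⊆ Ico 0 R := fun x hx => ⟨hx.1, hx.2.trans_lt hx₀.2⟩
    have hZ₀ := HasTwoDerivsOn.wronskian_nonneg (hv.derivs.mono hsub) (hu.derivs.mono hsub)
      (fun x hx => wronskian_deriv_nonneg hp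
        (ha_pos x ⟨hx.1.le, (hx.2.trans hx₀.2).le⟩).le
        (hu.pos x (hsub (Ioo_subset_Icc_self hx)) hx.1)
        (huv x (hsub (Ioo_subset_Icc_self hx))) le_rfl le_rfl)
      (B.wronskian_eq_zero hu.boundary hv.boundary).ge (right_mem_Icc.2 hx₀.1.le)
    have hu0 := hu.pos x₀ (Ioo_subset_Ico_self hx₀) hx₀.1
    have hv0 := hu0.trans hlt₀
    have hder := (hv.derivs.wronskian hu.derivs (Ioo_subset_Ico_self hx₀)).hasDerivAt (hnhds x₀ hx₀)
    have hpos : 0 < (a x₀ * (|v x₀| ^ (p - 1) * v x₀) - l * v x₀) * u x₀ -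
        v x₀ * (a x₀ * (|u x₀| ^ (p - 1) * u x₀) - l * u x₀) := by
      have h1 : |u x₀| ^ (p - 1) < |v x₀| ^ (p - 1) := by
        rw [abs_of_pos hu0, abs_of_pos hv0]
        exact Real.rpow_lt_rpow hu0.le hlt₀ (by linarith)
      have h2 := mul_pos (mul_pos (mul_pos (ha_pos x₀ (Ioo_subset_Icc_self hx₀)) hu0) hv0)
        (sub_pos.2 h1)
      linarith
    have hev := ((hud x₀ hx₀).continuousAt.eventually_lt (hvd x₀ hx₀).continuousAt
      hlt₀).filter_mono (nhdsWithin_le_nhds (s := Ioi x₀))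
    obtain ⟨z, ⟨hz1, hz2⟩, hz3⟩ := ((hev.and (hder.eventually_gt_right hpos)).and
      (Ioo_mem_nhdsGT hx₀.2)).exists
    exact ⟨z, ⟨hx₀.1.trans hz3.1, hz3.2⟩, hz1, hZ₀.trans_lt hz2⟩
  obtain ⟨c, hc, hltc, hZc⟩ : ∃ c ∈ Ioo x₁ R, u c < v x₁ ∧ 0 < v' x₁ * u c - v x₁ * u' c := by
    have hcu := (hud x₁ hx₁).continuousAt
    have hcZ : ContinuousAt (fun c => v' x₁ * u c - v x₁ * u' c) x₁ :=
      (hcu.const_mul _).sub ((hud' x₁ hx₁).continuousAt.const_mul _)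
    have hev := ((hcu.eventually (eventually_lt_nhds hlt₁)).and
      (hcZ.eventually (eventually_gt_nhds hZ₁))).filter_mono (nhdsWithin_le_nhds (s := Ioi x₁))
    obtain ⟨z, ⟨hz1, hz2⟩, hz3⟩ := (hev.and (Ioo_mem_nhdsGT hx₁.2)).exists
    exact ⟨z, hz3, hz1, hz2⟩
  set δ := c - x₁ with hδ
  have hδ0 : 0 < δ := sub_pos.2 hc.1
  have hmem : ∀ x ∈ Icc c R, x - δ ∈ Ioo 0 R := fun x hx =>
    ⟨by linarith [hx.1, hx₁.1], by linarith [hx.2]⟩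
  have hshift : HasTwoDerivsOn (Icc c R) (fun x => v (x - δ)) (fun x => v' (x - δ))
      (fun x => a (x - δ) * (|v (x - δ)| ^ (p - 1) * v (x - δ)) - l * v (x - δ)) :=
    .of_forall (fun x hx => (hvd _ (hmem x hx)).comp_sub_const x δ)
      (fun x hx => (hvd' _ (hmem x hx)).comp_sub_const x δ)
  have hsubc : Ico c R ⊆ Ico 0 R := Ico_subset_Ico_left (hx₁.1.trans hc.1).le
  have hcδ : c - δ = x₁ := by rw [hδ]; ring
  have hfin := comparison_of_tendsto hshift (hu.derivs.mono hsubc)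
    (fun x hx => hu.pos x (hsubc (Ioo_subset_Ico_self hx)) (hx₁.1.trans (hc.1.trans hx.1)))
    (fun x hx hltx => ?_) ?_ hblow c ⟨le_rfl, hc.2⟩
  · simp only [hcδ] at hfin
    linarith
  · have hxR : x ∈ Icc 0 R := ⟨(hx₁.1.trans (hc.1.trans hx.1)).le, hx.2.le⟩
    have hxδ := hmem x (Ioo_subset_Icc_self hx)
    have hux := hu.pos x (hsubc (Ioo_subset_Ico_self hx)) (hx₁.1.trans (hc.1.trans hx.1))
    refine wronskian_deriv_nonneg hp (ha_pos x hxR).le hux hltx.le ?_ le_rfl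
    have h1 : a x ≤ a (x - δ) := hanti (Ioo_subset_Icc_self hxδ) hxR (by linarith)
    have h2 : 0 < v (x - δ) := hux.trans hltx
    have h3 : 0 ≤ |v (x - δ)| ^ (p - 1) * v (x - δ) := by positivity
    linarith [mul_le_mul_of_nonneg_right h1 h3]
  · simp only [hcδ]
    exact hZc.le

theorem theorem1p2 (R p : ℝ) (hR : 0 < R) (hp : 1 < p) (a : ℝ → ℝ)
    (ha : ContinuousOn a (Icc 0 R)) (ha_pos : ∀ x ∈ Icc 0 R, 0 < a x) (B : BoundaryOp) :
    ∃ Lmin Lmax : ℝ → ℝ → ℝ,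
      -- minimal and maximal positive solutions for every value of the parameter
      (∀ l : ℝ, IsMinimalPositiveSolution R p a B l (Lmin l) ∧
        IsMaximalPositiveSolution R p a B l (Lmax l)) ∧
      -- the minimal solution as the parameter tends to `+∞`
      (B ≠ BoundaryOp.dirichlet → TendstoInftyOnCompacts Lmin (Ico 0 R)) ∧
      (B = BoundaryOp.dirichlet →
        TendstoInftyOnCompacts Lmin (Ioo 0 R) ∧ ∀ l : ℝ, Lmin l 0 = 0) ∧
      -- the maximal solution as the parameter tends to `-∞`
      (∀ K ⊆ Ico 0 R, IsCompact K → TendstoUniformlyOn Lmax (fun _ => 0) atBot K) ∧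
      -- uniqueness for non-increasing weights
      (AntitoneOn a (Icc 0 R) →
        (B = BoundaryOp.dirichlet ∨ B = BoundaryOp.neumann ∨
          ∃ β : ℝ, β < 0 ∧ B = BoundaryOp.robin β) →
        ∀ l : ℝ, 0 ≤ l →
          EqOn (Lmin l) (Lmax l) (Ico 0 R) ∧
          ∀ u : ℝ → ℝ, IsPositiveSolution R p a B l u → EqOn u (Lmin l) (Ico 0 R)) := by
  choose Lmin Lmin' hmin hmin_blow hmin_le using exists_minimal B hp hR ha ha_pos
  choose Lmax Lmax' hmax hmax_blow hmax_le using exists_maximal B hp hR ha ha_pos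
  refine ⟨Lmin, Lmax, fun l => ⟨⟨?_, ?_⟩, ?_, ?_⟩, fun hB K hKR hK M => ?_, ?_, fun K hKR hK => ?_,
    fun hanti _ l _ => ?_⟩
  · exact (hmin l).isPositiveSolution hR hp ha (hmin_blow l)
  · exact fun v hv => hmin_le l v _ hv.isSolOn hv.blowup
  · exact (hmax l).isPositiveSolution hR hp ha (hmax_blow l)
  · exact fun v hv => hmax_le l v _ hv.isSolOn
  · filter_upwards [eventually_gt_of_ne_dirichlet hp hR ha ha_pos hB hKR hK M] with l hl
    exact hl _ _ (hmin l)
  · rintro rfl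
    refine ⟨fun K hKR hK M => ?_, fun l => (hmin l).boundary⟩
    filter_upwards [eventually_gt_of_dirichlet hp hR ha ha_pos hKR hK M] with l hl
    exact hl _ _ (hmin l)
  · rw [Metric.tendstoUniformlyOn_iff]
    intro ε hε
    filter_upwards [eventually_lt_atBot B hp hR ha ha_pos hKR hK hε] with l hl x hx
    obtain ⟨b, hxb, hbR⟩ := exists_between (hKR hx).2
    have h0 : 0 ≤ Lmax l x :=
      ((hmax l).mono fun y hy => ⟨hy.1, hy.2.trans_lt hbR⟩).nonneg ((hKR hx).1.trans_lt hxb)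
        ⟨(hKR hx).1, hxb.le⟩
    rw [Real.dist_eq, zero_sub, abs_neg, abs_of_nonneg h0]
    exact hl _ _ (hmax l) x hx
  · have hle : ∀ x ∈ Ico 0 R, Lmin l x ≤ Lmax l x := hmax_le l _ _ (hmin l)
    have hge := le_of_antitoneOn hp ha_pos hanti (hmin l) (hmax l) (hmin_blow l) hle
    refine ⟨fun x hx => le_antisymm (hle x hx) (hge x hx), fun u hu x hx => le_antisymm ?_ ?_⟩
    · exact (hmax_le l u _ hu.isSolOn x hx).trans (hge x hx)
    · exact hmin_le l u _ hu.isSolOn hu.blowup x hx
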